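/- Let $\pi$ be a group, let $\mathbb{Z}[\pi]$ carry the involution $\overline{\sum n_g g}=\sum n_g g^{-1}$, and let $k,m,n\ge 0$ satisfy $4k=2n+2m$. Let $(C,\phi)$ be a $2n$-dimensional symmetric Poincaré complex over $\mathbb{Z}[\pi]$: a finite chain complex $C$ of based finitely generated free left $\mathbb{Z}[\pi]$-modules together with morphisms $\phi_s\colon C^{2n-r+s}\to C_r$ ($s\ge 0$) such that $d\phi_s+(-1)^r\phi_s d^*+(-1)^{2n+s-1}(\phi_{s-1}+(-1)^sT\phi_{s-1})=0$ (with $\phi_{-1}=0$ and $T\psi=(-1)^{pq}\psi^*$ for $\psi\colon C^p\to C_q$) and such that $\phi_0\colon C^{2n-*}\to C$ is a chain equivalence. Let $(A,\alpha,U)$ be a $(\mathbb{Z},m)$-symmetric representation of $\mathbb{Z}[\pi]$: a finitely generated free abelian group $A$, a nonsingular $(-1)^m$-symmetric form $\alpha\colon A\to A^*$, and a morphism of rings with involution $U\colon\mathbb{Z}[\pi]\to\mathrm{Hom}_{\mathbb{Z}}(A,A)^{op}$, where the involution on the target is $h\mapsto\alpha^{-1}h^*\alpha$. Let $\epsilon$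 denote the trivial action $\epsilon(\sum n_g g)=(\sum n_g)\cdot 1_A$. Let $(D,\Gamma)=(C,\phi)\otimes\bar S^m(A,\alpha,U)$ be the $4k$-dimensional symmetric Poincaré complex over $\mathbb{Z}$ in which $D_{r+m}=A^{c_r}$ for $C_r=\mathbb{Z}[\pi]^{c_r}$, the differential is obtained by applying $U$ to the matrix entries of $d_C$, and $\Gamma_s$ is, on $C^p\otimes A^*\to C_q\otimes A$, the composite of $\alpha^{-1}$ and the matrix $U(\phi_s)$, with the sign $(-1)^{pm}$. Let $(D',\Gamma')=(C,\phi)\otimes\bar S^m(A,\alpha,\epsilon)$ be the same product formed with the trivial action. If the representation is $\mathbb{Z}_4$-trivial, that is, $U(r)\otimes 1=\epsilon(r)\otimes 1\colon A\otimes\mathbb{Z}_4\to A\otimes\mathbb{Z}_4$ for all $r\in\mathbb{Z}[\pi]$, then $$\sigma(D,\Gamma)\equiv\sigma(D',\Gamma')\pmod 8,$$ where $\sigma$ denotes the signature of the symmetric bilinear form induced by $\Gamma_0$ (respectively $\Gamma'_0$) on the cohomology $H^{2k}(\,\cdot\,;\mathbb{R})$. -/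

import Mathlib

open scoped Matrix TensorProduct

/-! ### The group ring as a ring with involution -/

/-- The standard involution `∑ n_g g ↦ ∑ n_g g⁻¹` on the integral group ring `ℤ[π]`. -/
noncomputable instance groupRingStarRing {π : Type*} [Group π] :
    StarRing (MonoidAlgebra ℤ π) where
  star x := MonoidAlgebra.mapDomain (fun g : π => g⁻¹) x
  star_involutive x := by
    induction x using MonoidAlgebra.induction_linear with
    | zero => simp
    | add f g hf hg => simp only [MonoidAlgebra.mapDomain_add, hf, hg]
    | single g n => simp
  star_mul x y := by
    induction x using MonoidAlgebra.induction_linear with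
    | zero => simp
    | add f g hf hg => simp only [add_mul, mul_add, MonoidAlgebra.mapDomain_add, hf, hg]
    | single g n =>
      induction y using MonoidAlgebra.induction_linear with
      | zero => simp
      | add f g hf hg => simp only [add_mul, mul_add, MonoidAlgebra.mapDomain_add, hf, hg]
      | single h k => simp [MonoidAlgebra.single_mul_single, mul_comm]
  star_add x y := MonoidAlgebra.mapDomain_add _ _ _

/-- The augmentation `ℤ[π] → ℤ`, `∑ n_g g ↦ ∑ n_g`. -/
noncomputable def groupRingAugmentation (π : Type*) [Group π] : MonoidAlgebra ℤ π →+* ℤ :=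
  (MonoidAlgebra.lift ℤ ℤ π (1 : π →* ℤ)).toRingHom

/-! ### Finite chain complexes of based f.g. free modules -/

/-- A finite chain complex in the additive category of based finitely generated free left
`R`-modules. The module in degree `r` is `R ^ (ι r)`, and a morphism `R ^ I → R ^ J` is an
`I × J` matrix, acting on row vectors from the right; thus "first `f`, then `g`" is the matrix
product `f * g`. The entry `d i j` is the differential from degree `i` to degree `j`; it vanishes
unless `i = j + 1`. -/
structure BasedComplex (R : Type*) [Ring R] where
  ι : ℤ → Type
  [fintype : ∀ r, Fintype (ι r)]
  [decEq : ∀ r, DecidableEq (ι r)]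
  finite : ∃ N : ℤ, ∀ r, N < |r| → IsEmpty (ι r)
  d : ∀ i j, Matrix (ι i) (ι j) R
  shape : ∀ i j, i ≠ j + 1 → d i j = 0
  d_comp_d : ∀ i j k, d i j * d j k = 0

attribute [instance] BasedComplex.fintype BasedComplex.decEq

namespace BasedComplex

variable {R : Type*} [Ring R]

/-- A family of morphisms `f r : C_r → D_r` is a chain map. -/
def IsChainMap (C D : BasedComplex R) (f : ∀ r, Matrix (C.ι r) (D.ι r) R) : Prop :=
  ∀ i j, C.d i j * f j = f i * D.d i j

/-- `f` and `g` are chain homotopic. -/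
def Homotopic (C D : BasedComplex R) (f g : ∀ r, Matrix (C.ι r) (D.ι r) R) : Prop :=
  ∃ h : ∀ i j, Matrix (C.ι i) (D.ι j) R,
    ∀ r, f r - g r = C.d r (r - 1) * h (r - 1) r + h r (r + 1) * D.d (r + 1) r

/-- `f` is a chain equivalence: a chain map with a chain homotopy inverse. -/
def IsChainEquivalence (C D : BasedComplex R) (f : ∀ r, Matrix (C.ι r) (D.ι r) R) : Prop :=
  IsChainMap C D f ∧ ∃ g : ∀ r, Matrix (D.ι r) (C.ι r) R, IsChainMap D C g ∧
    Homotopic C C (fun r => f r * g r) (fun _ => 1) ∧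
    Homotopic D D (fun r => g r * f r) (fun _ => 1)

/-- The `n`-dual complex `C^{n-*}`: the module in degree `r` is the dual
`C^{n-r} = Hom_R (C_{n-r}, R)`, a left `R`-module through the involution, with the dual basis,
and the differential is `(-1)^r d^* : C^{n-r} → C^{n-r+1}`. In the dual bases, the matrix of the
dual of a morphism is the conjugate transpose. -/
def dual [StarRing R] (C : BasedComplex R) (n : ℤ) : BasedComplex R where
  ι r := C.ι (n - r)
  finite := by
    obtain ⟨N, hN⟩ := C.finite
    refine ⟨N + |n|, fun r hr => hN _ ?_⟩
    have := abs_sub_abs_le_abs_sub r n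
    rw [abs_sub_comm]
    linarith
  d i j := i.negOnePow • (C.d (n - j) (n - i))ᴴ
  shape i j h := by
    rw [C.shape _ _ (by omega)]
    simp
  d_comp_d i j k := by
    rw [Matrix.smul_mul, Matrix.mul_smul, ← Matrix.conjTranspose_mul, C.d_comp_d]
    simp

end BasedComplex

/-! ### Symmetric complexes -/

/-- An `n`-dimensional symmetric complex `(C, φ)` over a ring with involution `R`: a finite complex
of based f.g. free `R`-modules and a symmetric structure, that is, morphisms
`φ s p q : C^p → C_q` for `s ≥ 0` and `p + q = n + s` which satisfy
`d φ_s + (-1)^q φ_s d^* + (-1)^{n+s-1} (φ_{s-1} + (-1)^s T φ_{s-1}) = 0 : C^p → C_q`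
for `p + q = n + s - 1`, where `φ_{-1} = 0` and `T ψ = (-1)^{pq} ψ^*`. Equivalently, `φ` is an
`n`-cycle of `Hom_{ℤ[ℤ₂]} (W, Hom_R (C^{-*}, C))`, with `W` the standard free resolution. -/
structure SymmetricComplex (R : Type*) [Ring R] [StarRing R] (n : ℤ) extends BasedComplex R where
  φ : ∀ (_ : ℕ) (p q : ℤ), Matrix (ι p) (ι q) R
  φ_shape : ∀ (s : ℕ) (p q : ℤ), p + q ≠ n + s → φ s p q = 0
  φ_zero : ∀ p p' q q' : ℤ, p' = p + 1 → q' = q + 1 → p + q' = n →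
    φ 0 p q' * d q' q + q.negOnePow • ((d p' p)ᴴ * φ 0 p' q) = 0
  φ_succ : ∀ (s : ℕ) (p p' q q' : ℤ), p' = p + 1 → q' = q + 1 → p + q' = n + (s + 1) →
    φ (s + 1) p q' * d q' q + q.negOnePow • ((d p' p)ᴴ * φ (s + 1) p' q)
      + (n + s).negOnePow •
        (φ s p q + ((s + 1 : ℤ).negOnePow * (p * q).negOnePow) • (φ s q p)ᴴ) = 0

namespace SymmetricComplex

/-- `(C, φ)` is Poincaré if `φ_0 : C^{n-*} → C` is a chain equivalence. -/
def IsPoincare {R : Type*} [Ring R] [StarRing R] {n : ℤ} (C : SymmetricComplex R n) : Prop :=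
  BasedComplex.IsChainEquivalence (C.toBasedComplex.dual n) C.toBasedComplex
    (fun r => C.φ 0 (n - r) r)

/-! ### The signature of a `4k`-dimensional symmetric complex over `ℤ` -/

/-- The coboundary map from real `p`-cochains to real `q`-cochains (of interest for `q = p + 1`).
A real `p`-cochain `x : C_p → ℝ` is identified with its values on the basis of `C_p`. -/
noncomputable def coboundary {n : ℤ} (C : SymmetricComplex ℤ n) (p q : ℤ) :
    (C.ι p → ℝ) →ₗ[ℝ] (C.ι q → ℝ) :=
  ((C.d q p).map (Int.cast : ℤ → ℝ)).mulVecLin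

/-- The real `p`-cocycles. -/
noncomputable abbrev cocycles {n : ℤ} (C : SymmetricComplex ℤ n) (p : ℤ) :
    Submodule ℝ (C.ι p → ℝ) :=
  LinearMap.ker (C.coboundary p (p + 1))

/-- The real `p`-coboundaries, as a subspace of the `p`-cocycles. -/
noncomputable abbrev coboundaries {n : ℤ} (C : SymmetricComplex ℤ n) (p : ℤ) :
    Submodule ℝ (C.cocycles p) :=
  (LinearMap.range (C.coboundary (p - 1) p)).submoduleOf (C.cocycles p)

/-- The real cohomology `H^p (C; ℝ)`. -/
noncomputable abbrev cohomology {n : ℤ} (C : SymmetricComplex ℤ n) (p : ℤ) : Type :=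
  C.cocycles p ⧸ C.coboundaries p

/-- The bilinear form `φ_0 (x, y) = ∑ i j, x i * φ_0 i j * y j` on real `p`-cochains. -/
noncomputable def cochainForm {n : ℤ} (C : SymmetricComplex ℤ n) (p : ℤ) :
    LinearMap.BilinForm ℝ (C.ι p → ℝ) :=
  Matrix.toBilin' ((C.φ 0 p p).map (Int.cast : ℤ → ℝ))

lemma cochainForm_apply {n : ℤ} (C : SymmetricComplex ℤ n) (p : ℤ) (x y : C.ι p → ℝ) :
    C.cochainForm p x y = x ⬝ᵥ ((C.φ 0 p p).map (Int.cast : ℤ → ℝ)) *ᵥ y := by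
  rw [cochainForm, Matrix.toBilin'_apply']

lemma cochainForm_right {n : ℤ} (C : SymmetricComplex ℤ n) (p : ℤ) (hp : p + p = n)
    (x : C.ι p → ℝ) (hx : x ∈ C.cocycles p) (y : C.ι p → ℝ)
    (hy : y ∈ LinearMap.range (C.coboundary (p - 1) p)) : C.cochainForm p x y = 0 := by
  obtain ⟨z, rfl⟩ := hy
  have hx' : ((C.d (p + 1) p).map (Int.cast : ℤ → ℝ)) *ᵥ x = 0 := hx
  have h := C.φ_zero p (p + 1) (p - 1) p rfl (by ring) hp
  have h1 : C.φ 0 p p * C.d p (p - 1) =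
      -((p - 1).negOnePow • ((C.d (p + 1) p)ᵀ * C.φ 0 (p + 1) (p - 1))) := by
    rw [← Matrix.conjTranspose_eq_transpose_of_trivial]
    exact eq_neg_of_add_eq_zero_left h
  have h2 := congrArg (fun M => M.map (Int.castRingHom ℝ)) h1
  simp only [Matrix.map_mul] at h2
  rw [cochainForm_apply, coboundary, Matrix.mulVecLin_apply, Matrix.mulVec_mulVec]
  have h3 : ((C.φ 0 p p).map (Int.cast : ℤ → ℝ)) * ((C.d p (p - 1)).map (Int.cast : ℤ → ℝ)) =
      ((C.d (p + 1) p).map (Int.cast : ℤ → ℝ))ᵀ *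
        (-((p - 1).negOnePow • (C.φ 0 (p + 1) (p - 1)))).map (Int.cast : ℤ → ℝ) := by
    refine h2.trans ?_
    rw [← Matrix.mul_smul, ← Matrix.mul_neg]
    rw [Matrix.map_mul]
    rfl
  rw [h3, ← Matrix.mulVec_mulVec, Matrix.dotProduct_mulVec, Matrix.vecMul_transpose, hx',
    zero_dotProduct]

lemma cochainForm_left {n : ℤ} (C : SymmetricComplex ℤ n) (p : ℤ) (hp : p + p = n)
    (x : C.ι p → ℝ) (hx : x ∈ LinearMap.range (C.coboundary (p - 1) p))
    (y : C.ι p → ℝ) (hy : y ∈ C.cocycles p) : C.cochainForm p x y = 0 := by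
  obtain ⟨z, rfl⟩ := hx
  have hy' : ((C.d (p + 1) p).map (Int.cast : ℤ → ℝ)) *ᵥ y = 0 := hy
  have h := C.φ_zero (p - 1) p p (p + 1) (by ring) rfl (by rw [← hp]; ring)
  have h1 : (C.d p (p - 1))ᵀ * C.φ 0 p p =
      (-(p.negOnePow • C.φ 0 (p - 1) (p + 1))) * C.d (p + 1) p := by
    rw [← Matrix.conjTranspose_eq_transpose_of_trivial, Matrix.neg_mul, Matrix.smul_mul,
      eq_neg_of_add_eq_zero_left h, smul_neg, smul_smul, Int.units_mul_self, one_smul, neg_neg]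
  have h2 := congrArg (fun M => M.map (Int.castRingHom ℝ)) h1
  simp only [Matrix.map_mul] at h2
  have h3 : ((C.d p (p - 1)).map (Int.cast : ℤ → ℝ))ᵀ * ((C.φ 0 p p).map (Int.cast : ℤ → ℝ)) =
      (-(p.negOnePow • C.φ 0 (p - 1) (p + 1))).map (Int.cast : ℤ → ℝ) *
        ((C.d (p + 1) p).map (Int.cast : ℤ → ℝ)) := h2
  rw [cochainForm_apply, coboundary, Matrix.mulVecLin_apply, ← Matrix.vecMul_transpose,
    ← Matrix.dotProduct_mulVec, Matrix.mulVec_mulVec, h3, ← Matrix.mulVec_mulVec, hy',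
    Matrix.mulVec_zero, dotProduct_zero]

/-- The bilinear form on `H^p (C; ℝ)` induced by `φ_0`, for `C` of dimension `n = 2p`. -/
noncomputable def cohomologyForm {n : ℤ} (C : SymmetricComplex ℤ n) (p : ℤ) (hp : p + p = n) :
    LinearMap.BilinForm ℝ (C.cohomology p) :=
  (C.coboundaries p).liftQ
    { toFun := fun x => (C.coboundaries p).liftQ
        ((C.cochainForm p x.1).comp (C.cocycles p).subtype)
        (fun y hy => C.cochainForm_right p hp x.1 x.2 y.1 hy)
      map_add' := fun x x' => by
        refine Submodule.linearMap_qext _ (LinearMap.ext fun y => ?_)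
        change C.cochainForm p (x.1 + x'.1) y.1 =
          C.cochainForm p x.1 y.1 + C.cochainForm p x'.1 y.1
        simp
      map_smul' := fun c x => by
        refine Submodule.linearMap_qext _ (LinearMap.ext fun y => ?_)
        change C.cochainForm p (c • x.1) y.1 = c • C.cochainForm p x.1 y.1
        simp }
    (fun x hx => by
      rw [LinearMap.mem_ker]
      refine Submodule.linearMap_qext _ (LinearMap.ext fun y => ?_)
      exact C.cochainForm_left p hp x.1 hx y.1 y.2)

/-- The signature of a `4k`-dimensional symmetric complex over `ℤ`: the number of positive minus
the number of negative summands of the form induced by `φ_0` on `H^{2k} (C; ℝ)`. -/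
noncomputable def signature {k : ℤ} (C : SymmetricComplex ℤ (4 * k)) : ℤ :=
  (sigPos (C.cohomologyForm (2 * k) (by ring)).toQuadraticMap : ℤ)
    - (sigNeg (C.cohomologyForm (2 * k) (by ring)).toQuadraticMap : ℤ)

end SymmetricComplex

/-! ### Symmetric representations -/

/-- A `(ℤ, m)`-symmetric representation `(A, α, U)` of the group ring `ℤ[π]`: a nonsingular
`(-1)^m`-symmetric form `α : A → A^*` together with a morphism of rings with involution
`U : ℤ[π] → Hom_ℤ (A, A)^op`, where the involution on the target is `h ↦ α⁻¹ h^* α`. -/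
structure SymmetricRepresentation (π A : Type*) [Group π] [AddCommGroup A] (m : ℕ) where
  α : A →ₗ[ℤ] Module.Dual ℤ A
  nonsingular : Function.Bijective α
  symm : ∀ x y, α x y = (-1) ^ m * α y x
  U : MonoidAlgebra ℤ π →+* (Module.End ℤ A)ᵐᵒᵖ
  U_star : ∀ r x y, α ((U (star r)).unop x) y = α x ((U r).unop y)

namespace SymmetricRepresentation

variable {π A : Type*} [Group π] [AddCommGroup A] {m : ℕ}

/-- The trivial action `ε : ℤ[π] → Hom_ℤ (A, A)^op`, `∑ n_g g ↦ (∑ n_g) • 1`. -/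
noncomputable def trivialAction (π A : Type*) [Group π] [AddCommGroup A] :
    MonoidAlgebra ℤ π →+* (Module.End ℤ A)ᵐᵒᵖ :=
  (Int.castRingHom (Module.End ℤ A)ᵐᵒᵖ).comp (groupRingAugmentation π)

lemma trivialAction_apply (r : MonoidAlgebra ℤ π) (x : A) :
    (trivialAction π A r).unop x = groupRingAugmentation π r • x := by
  simp [trivialAction]

lemma groupRingAugmentation_star (r : MonoidAlgebra ℤ π) :
    groupRingAugmentation π (star r) = groupRingAugmentation π r := by
  induction r using MonoidAlgebra.induction_linear with
  | zero => simp
  | add f g hf hg => simp only [star_add, map_add, hf, hg]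
  | single g n =>
    change groupRingAugmentation π (MonoidAlgebra.mapDomain _ _) = _
    simp [groupRingAugmentation]

/-- The representation `(A, α, ε)` with the trivial action, on the form of `(A, α, U)`. -/
noncomputable def trivial (ρ : SymmetricRepresentation π A m) : SymmetricRepresentation π A m where
  α := ρ.α
  nonsingular := ρ.nonsingular
  symm := ρ.symm
  U := trivialAction π A
  U_star r x y := by
    simp only [trivialAction_apply, groupRingAugmentation_star]
    simp

/-- `(A, α, U)` is `ℤ₄`-trivial: `U r ⊗ 1 = ε r ⊗ 1 : A ⊗ ℤ₄ → A ⊗ ℤ₄` for all `r ∈ ℤ[π]`. -/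
def IsZ4Trivial (ρ : SymmetricRepresentation π A m) : Prop :=
  ∀ r : MonoidAlgebra ℤ π, LinearMap.rTensor (ZMod 4) (ρ.U r).unop =
    LinearMap.rTensor (ZMod 4) (trivialAction π A r).unop

variable {κ : Type} [Fintype κ] [DecidableEq κ]

/-- `U` in matrix form, for a basis `b` of `A`. Matrices act on row vectors, so that
`Hom_ℤ (A, A)^op` is the matrix ring itself. -/
noncomputable def UMatrix (ρ : SymmetricRepresentation π A m) (b : Module.Basis κ ℤ A) :
    MonoidAlgebra ℤ π →+* Matrix κ κ ℤ where
  toFun r := (LinearMap.toMatrix b b (ρ.U r).unop)ᵀ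
  map_one' := by simp [LinearMap.toMatrix_one]
  map_mul' x y := by
    rw [map_mul, MulOpposite.unop_mul, LinearMap.toMatrix_mul, Matrix.transpose_mul]
  map_zero' := by simp
  map_add' x y := by simp

/-- The Gram matrix of `α`. -/
noncomputable def gram (ρ : SymmetricRepresentation π A m) (b : Module.Basis κ ℤ A) :
    Matrix κ κ ℤ :=
  Matrix.of fun i j => ρ.α (b i) (b j)

/-- The image `F f : A ^ I → A ^ J` of `f : R ^ I → R ^ J` under the transfer functor
`F = - ⊗ (A, U)`: every matrix entry `f i j` is replaced by `U (f i j)`. -/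
noncomputable def transfer (ρ : SymmetricRepresentation π A m) (b : Module.Basis κ ℤ A)
    {I J : Type} (f : Matrix I J (MonoidAlgebra ℤ π)) : Matrix (I × κ) (J × κ) ℤ :=
  Matrix.comp I J κ κ ℤ (f.map (ρ.UMatrix b))

/-- The composite `(A^*) ^ I → A ^ I → A ^ J` of `α⁻¹` in every coordinate and `F f`. -/
noncomputable def transferForm (ρ : SymmetricRepresentation π A m) (b : Module.Basis κ ℤ A)
    {I J : Type} (f : Matrix I J (MonoidAlgebra ℤ π)) : Matrix (I × κ) (J × κ) ℤ :=
  Matrix.comp I J κ κ ℤ (f.map fun r => (ρ.gram b)⁻¹ * ρ.UMatrix b r)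

variable (ρ : SymmetricRepresentation π A m) (b : Module.Basis κ ℤ A)

set_option linter.unusedSectionVars false

lemma isUnit_gram_det : IsUnit (ρ.gram b).det := by
  have h := LinearEquiv.isUnit_det (LinearEquiv.ofBijective ρ.α ρ.nonsingular) b b.dualBasis
  have e : LinearMap.toMatrix b b.dualBasis
      (LinearEquiv.ofBijective ρ.α ρ.nonsingular : A →ₗ[ℤ] Module.Dual ℤ A) = (ρ.gram b)ᵀ := by
    ext i j
    simp [LinearMap.toMatrix_apply, gram]
  rwa [e, Matrix.det_transpose] at h

lemma gram_transpose : (ρ.gram b)ᵀ = (-1 : ℤ) ^ m • ρ.gram b := by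
  ext i j
  simpa [gram] using ρ.symm (b j) (b i)

lemma UMatrix_star_mul_gram (r : MonoidAlgebra ℤ π) :
    ρ.UMatrix b (star r) * ρ.gram b = ρ.gram b * (ρ.UMatrix b r)ᵀ := by
  ext i j
  have h := ρ.U_star r (b i) (b j)
  rw [← b.sum_repr ((ρ.U (star r)).unop (b i)), ← b.sum_repr ((ρ.U r).unop (b j))] at h
  simp only [map_sum, map_smul, LinearMap.sum_apply, LinearMap.smul_apply, smul_eq_mul] at h
  simpa [Matrix.mul_apply, UMatrix, gram, LinearMap.toMatrix_apply, mul_comm] using h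

lemma UMatrix_transpose_mul (r : MonoidAlgebra ℤ π) :
    (ρ.UMatrix b r)ᵀ * (ρ.gram b)⁻¹ = (ρ.gram b)⁻¹ * ρ.UMatrix b (star r) := by
  have hu := ρ.isUnit_gram_det b
  calc (ρ.UMatrix b r)ᵀ * (ρ.gram b)⁻¹
      = (ρ.gram b)⁻¹ * (ρ.gram b * (ρ.UMatrix b r)ᵀ) * (ρ.gram b)⁻¹ := by
        rw [Matrix.nonsing_inv_mul_cancel_left _ _ hu]
    _ = (ρ.gram b)⁻¹ * ρ.UMatrix b (star r) := by
        rw [← UMatrix_star_mul_gram, ← Matrix.mul_assoc, Matrix.mul_nonsing_inv_cancel_right _ _ hu]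

lemma gram_inv_transpose : ((ρ.gram b)⁻¹)ᵀ = (-1 : ℤ) ^ m • (ρ.gram b)⁻¹ := by
  have hu := ρ.isUnit_gram_det b
  rw [Matrix.transpose_nonsing_inv, gram_transpose]
  refine Matrix.inv_eq_left_inv ?_
  rw [Matrix.smul_mul, Matrix.mul_smul, smul_smul, Matrix.nonsing_inv_mul _ hu, ← mul_pow]
  simp

lemma comp_mul_comp {I J L : Type} [Fintype J] (X : Matrix I J (Matrix κ κ ℤ))
    (Y : Matrix J L (Matrix κ κ ℤ)) :
    Matrix.comp I J κ κ ℤ X * Matrix.comp J L κ κ ℤ Y = Matrix.comp I L κ κ ℤ (X * Y) := by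
  ext ⟨i, a⟩ ⟨l, c⟩
  simp [Matrix.mul_apply, Matrix.sum_apply, Fintype.sum_prod_type]

lemma transfer_mul {I J L : Type} [Fintype J] (f : Matrix I J (MonoidAlgebra ℤ π))
    (g : Matrix J L (MonoidAlgebra ℤ π)) :
    ρ.transfer b f * ρ.transfer b g = ρ.transfer b (f * g) := by
  rw [transfer, transfer, transfer, comp_mul_comp, Matrix.map_mul]

lemma transferForm_mul_transfer {I J L : Type} [Fintype J] (f : Matrix I J (MonoidAlgebra ℤ π))
    (g : Matrix J L (MonoidAlgebra ℤ π)) :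
    ρ.transferForm b f * ρ.transfer b g = ρ.transferForm b (f * g) := by
  rw [transfer, transferForm, transferForm, comp_mul_comp]
  congr 1
  ext1 i l
  simp [Matrix.mul_apply, Finset.mul_sum, map_sum, Matrix.mul_assoc]

lemma transfer_transpose_mul {I J L : Type} [Fintype J] (f : Matrix J I (MonoidAlgebra ℤ π))
    (g : Matrix J L (MonoidAlgebra ℤ π)) :
    (ρ.transfer b f)ᵀ * ρ.transferForm b g = ρ.transferForm b (fᴴ * g) := by
  have e : (ρ.transfer b f)ᵀ =
      Matrix.comp I J κ κ ℤ (Matrix.of fun i j => (ρ.UMatrix b (f j i))ᵀ) := by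
    ext ⟨i, a⟩ ⟨j, c⟩
    simp [transfer]
  rw [e, transferForm, transferForm, comp_mul_comp]
  congr 1
  ext1 i l
  simp only [Matrix.mul_apply, Matrix.map_apply, Matrix.of_apply, map_sum, Finset.mul_sum,
    Matrix.conjTranspose_apply, map_mul, ← Matrix.mul_assoc, UMatrix_transpose_mul]

lemma transferForm_transpose {I J : Type} (f : Matrix I J (MonoidAlgebra ℤ π)) :
    (ρ.transferForm b f)ᵀ = (-1 : ℤ) ^ m • ρ.transferForm b fᴴ := by
  ext ⟨j, c⟩ ⟨i, a⟩
  have h : ((ρ.gram b)⁻¹ * ρ.UMatrix b (f i j))ᵀ =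
      (-1 : ℤ) ^ m • ((ρ.gram b)⁻¹ * ρ.UMatrix b (star (f i j))) := by
    rw [Matrix.transpose_mul, gram_inv_transpose, Matrix.mul_smul, UMatrix_transpose_mul]
  have h' := congrFun (congrFun h c) a
  simpa [transferForm] using h'

lemma transferForm_add {I J : Type} (f g : Matrix I J (MonoidAlgebra ℤ π)) :
    ρ.transferForm b (f + g) = ρ.transferForm b f + ρ.transferForm b g := by
  ext ⟨j, c⟩ ⟨i, a⟩
  simp [transferForm, Matrix.mul_add]

lemma transferForm_zero {I J : Type} :
    ρ.transferForm b (0 : Matrix I J (MonoidAlgebra ℤ π)) = 0 := by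
  ext ⟨j, c⟩ ⟨i, a⟩
  simp [transferForm]

lemma transferForm_smul {I J : Type} (u : ℤˣ) (f : Matrix I J (MonoidAlgebra ℤ π)) :
    ρ.transferForm b (u • f) = u • ρ.transferForm b f := by
  rcases Int.units_eq_one_or u with rfl | rfl
  · simp
  · ext ⟨j, c⟩ ⟨i, a⟩
    simp [transferForm]

end SymmetricRepresentation

/-! ### The product of a symmetric complex and a skew-suspended symmetric representation -/

namespace SymmetricComplex

open SymmetricRepresentation

variable {π A : Type*} [Group π] [AddCommGroup A] {m : ℕ} {κ : Type} [Fintype κ] [DecidableEq κ]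

/-- The symmetric complex `(C, φ) ⊗ S̄^m (A, α, U)` over `ℤ`, of dimension `N = n + 2m`, for an
`n`-dimensional symmetric complex `(C, φ)` over `ℤ[π]`, where `b` is a basis of `A`. Here
`S̄^m (A, α)` is `A` concentrated in degree `m`, so that the module in degree `r` is `A ^ ι (r - m)`
for `C_{r - m} = ℤ[π] ^ ι (r - m)`; the differential is `U (d)`; and the symmetric structure is
`(-1)^{pm} U (φ_s) α⁻¹ : C^p ⊗ A^* → C_q ⊗ A`. -/
noncomputable def tensor {n : ℤ} (C : SymmetricComplex (MonoidAlgebra ℤ π) n)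
    (ρ : SymmetricRepresentation π A m) (b : Module.Basis κ ℤ A) {N : ℤ} (hN : N = n + 2 * m) :
    SymmetricComplex ℤ N where
  ι r := C.ι (r - m) × κ
  finite := by
    obtain ⟨M, hM⟩ := C.finite
    refine ⟨M + m, fun r hr => ?_⟩
    have : IsEmpty (C.ι (r - m)) := by
      refine hM _ ?_
      have h1 := abs_sub_abs_le_abs_sub r (m : ℤ)
      have h2 : |(m : ℤ)| = m := abs_of_nonneg (by positivity)
      linarith
    infer_instance
  d i j := ρ.transfer b (C.d (i - m) (j - m))
  shape i j h := by
    rw [C.shape _ _ (by omega)]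
    ext ⟨i, a⟩ ⟨j, c⟩
    simp [transfer]
  d_comp_d i j k := by
    rw [transfer_mul, C.d_comp_d]
    ext ⟨i, a⟩ ⟨j, c⟩
    simp [transfer]
  φ s p q := ((p - m) * m).negOnePow • ρ.transferForm b (C.φ s (p - m) (q - m))
  φ_shape s p q h := by
    rw [C.φ_shape _ _ _ (by omega), transferForm_zero, smul_zero]
  φ_zero p p' q q' hp hq h := by
    have e := C.φ_zero (p - m) (p' - m) (q - m) (q' - m) (by omega) (by omega) (by omega)
    have e' := congrArg (ρ.transferForm b) e
    rw [transferForm_add, transferForm_smul, transferForm_zero, ← transferForm_mul_transfer,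
      ← transfer_transpose_mul] at e'
    rw [Matrix.conjTranspose_eq_transpose_of_trivial, Matrix.smul_mul, Matrix.mul_smul, smul_smul]
    have s1 : q.negOnePow * ((p' - m) * m).negOnePow =
        ((p - m) * m).negOnePow * (q - m).negOnePow := by
      rw [← Int.negOnePow_add, ← Int.negOnePow_add, Int.negOnePow_eq_iff]
      subst hp
      ring_nf
      exact ⟨m, by ring⟩
    rw [s1, mul_smul, ← smul_add, e', smul_zero]
  φ_succ s p p' q q' hp hq h := by
    have e := C.φ_succ s (p - m) (p' - m) (q - m) (q' - m) (by omega) (by omega) (by omega)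
    have e' := congrArg (ρ.transferForm b) e
    rw [transferForm_add, transferForm_add, transferForm_smul, transferForm_smul,
      transferForm_add, transferForm_smul, transferForm_zero, ← transferForm_mul_transfer,
      ← transfer_transpose_mul] at e'
    have t : (ρ.transferForm b (C.φ s (q - m) (p - m)))ᵀ =
        (m : ℤ).negOnePow • ρ.transferForm b (C.φ s (q - m) (p - m))ᴴ := by
      rw [transferForm_transpose]
      rw [Units.smul_def, Int.coe_negOnePow_natCast]
    have s1 : q.negOnePow * ((p' - m) * m).negOnePow =
        ((p - m) * m).negOnePow * (q - m).negOnePow := by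
      rw [← Int.negOnePow_add, ← Int.negOnePow_add, Int.negOnePow_eq_iff]
      subst hp
      ring_nf
      exact ⟨m, by ring⟩
    have s2 : (N + s).negOnePow = (n + s).negOnePow := by
      rw [Int.negOnePow_eq_iff]
      subst hN
      ring_nf
      exact ⟨m, by ring⟩
    have s3 : ((s + 1 : ℤ).negOnePow * (p * q).negOnePow) *
        (((q - m) * m).negOnePow * (m : ℤ).negOnePow) =
        ((p - m) * m).negOnePow * ((s + 1 : ℤ).negOnePow * ((p - m) * (q - m)).negOnePow) := by
      simp only [← Int.negOnePow_add]
      rw [Int.negOnePow_eq_iff]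
      ring_nf
      have := (Int.even_mul_succ_self (m : ℤ))
      obtain ⟨a, ha⟩ := this
      refine ⟨q * m - m * m + a, ?_⟩
      linear_combination ha
    rw [Matrix.conjTranspose_eq_transpose_of_trivial, Matrix.conjTranspose_eq_transpose_of_trivial,
      Matrix.smul_mul, Matrix.mul_smul, smul_smul, s1, s2, Matrix.transpose_smul, t]
    simp only [smul_smul]
    rw [s3, mul_smul, mul_smul ((p - m) * m).negOnePow, ← smul_add, ← smul_add, smul_comm,
      ← smul_add, e', smul_zero]

end SymmetricComplex

/-! The signature modulo 8 of a symmetric Poincaré complex over ℤ can be read off from its reduction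
modulo 4: the Gauss sum of `i ^ (x φ₀ x)` over the middle-dimensional cocycles `x` modulo 4 has
phase `exp (2πiσ/8)` (`SymmetricComplex.gaussSumModFour_signature`). Both products are built from
the same Gram matrix, so for a ℤ₄-trivial representation their differentials and their `φ₀` agree
modulo 4. The two Gauss sums are then the same number.

The phase is computed up to positive real factors (`PosProportional`), in three stages.

Removing torsion: a cocycle modulo 4 need not lift to an integral one. Translation by a torsion
cocycle `b` multiplies the term of `x` by `(-1) ^ (x φ b)`, so the sum is concentrated on those `x`
that pair evenly with all torsion cocycles. Nonsingularity of the linking form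
(`exists_coboundary_eq`) writes such an `x` as `z + 2w` modulo 4, with `z` an integral cocycle and
`w` a cocycle modulo 2, and the term depends on `z` only.

Diagonalising: on integral cocycles the form is unimodular modulo its radical (`exists_represents`).
With a rational diagonalisation into entries `a j`, the same cancellation argument
(`sum_posProportional_of_isotropic`) compares its Gauss sum with the product of the sums of `exp (πi
x² / 2a)` over `x` modulo `2a`, for `a = a j`.

Rank one: each factor has phase `exp (πi sign a / 4)` by the theta functional equation, and the
signs add up to the signature (`signature_eq_sum_sign`).

Poincaré duality enters only through `MiddleDuality`, which survives the transfer to ℤ because the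
Gram matrix of `α` intertwines transposition with the involution of the group ring. -/

/-! ### Quadratic Gauss sums of even modulus -/

/-- The function `x ↦ exp (π i x² / a)` on the integers. -/
noncomputable def gaussTerm (a : ℤ) (x : ℤ) : ℂ :=
  Complex.exp (Real.pi * Complex.I * ((x : ℂ) ^ 2 / a))

/-- Evenness of the modulus matters: the exponent changes by `πi` times `2(xy + ay²)`. For an odd
modulus the corresponding change could be odd. -/
lemma gaussTerm_periodic {a : ℤ} (ha : a ≠ 0) (x y : ℤ) :
    gaussTerm (2 * a) (x + 2 * a * y) = gaussTerm (2 * a) x := by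
  rw [gaussTerm, gaussTerm, Complex.exp_eq_exp_iff_exists_int]
  refine ⟨x * y + a * y ^ 2, ?_⟩
  have : (a : ℂ) ≠ 0 := by exact_mod_cast ha
  push_cast
  field_simp
  ring

lemma sum_fin_eq_sum_zmod_val {N : ℕ} [NeZero N] (h : ℕ → ℂ) :
    ∑ r : Fin N, h r = ∑ x : ZMod N, h x.val := by
  obtain ⟨k, rfl⟩ := Nat.exists_eq_succ_of_ne_zero (NeZero.ne N)
  rfl

lemma periodic_intCast_val {N : ℕ} [NeZero N] {h : ℤ → ℂ}
    (hh : ∀ x y, h (x + N * y) = h x) (x : ℤ) : h (x : ZMod N).val = h x := by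
  rw [ZMod.val_intCast]
  conv_rhs => rw [← Int.emod_add_mul_ediv x N]
  rw [hh]

lemma sum_zmod_val_add {N : ℕ} [NeZero N] {h : ℤ → ℂ} (hh : ∀ x y, h (x + N * y) = h x) (n : ℤ) :
    ∑ x : ZMod N, h (x.val + n) = ∑ x : ZMod N, h x.val := by
  rw [← Equiv.sum_comp (Equiv.addRight (n : ZMod N)) (fun x : ZMod N => h x.val)]
  refine Finset.sum_congr rfl fun x _ => ?_
  rw [← periodic_intCast_val hh]
  simp

/-! ### Evaluation of the Gauss sum by theta functions. -/

lemma jacobiTheta₂_real_I (x : ℝ) :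
    jacobiTheta₂ x Complex.I = ∑' n : ℤ, Complex.exp (-Real.pi * ((n : ℂ) + x) ^ 2) := by
  rw [← jacobiTheta₂_neg_left, jacobiTheta₂_functional_equation, jacobiTheta₂, ← tsum_mul_left]
  refine tsum_congr fun n => ?_
  have h1 : -Complex.I * Complex.I = 1 := by simp
  have h2 : (-1 : ℂ) / Complex.I = Complex.I := by simp
  rw [h1, h2, jacobiTheta₂_term, Complex.one_cpow, div_one, one_mul, ← Complex.exp_add]
  congr 1
  rw [div_eq_mul_inv, div_eq_mul_inv, Complex.inv_I]
  linear_combination (2 * Real.pi * n * x + Real.pi * x ^ 2 + Real.pi * n ^ 2 : ℂ) * Complex.I_sq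

/-- Splitting the theta series by residue classes modulo `N` turns it into Gaussian sums over the
shifted lattices `ℤ + r/N`. Poisson summation replaces these by values of `jacobiTheta₂`. Completing
the square then gives terms in `r + n`, and the sum over all residues `r` does not depend on `n`. -/
lemma jacobiTheta_eq_gaussSum_mul {N : ℕ} [NeZero N]
    (hp : ∀ x y : ℤ, gaussTerm N (x + N * y) = gaussTerm N x) :
    jacobiTheta ((N : ℂ)⁻¹ + Complex.I * (N : ℂ)⁻¹ ^ 2) =
      (∑ x : ZMod N, gaussTerm N x.val) * jacobiTheta (Complex.I - (N : ℂ)⁻¹) := by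
  have hN : (N : ℂ) ≠ 0 := by exact_mod_cast NeZero.ne N
  have hNr : (N : ℝ) ≠ 0 := by exact_mod_cast NeZero.ne N
  set τ : ℂ := (N : ℂ)⁻¹ + Complex.I * (N : ℂ)⁻¹ ^ 2 with hτ
  have hτ' : τ = ((N : ℝ)⁻¹ : ℝ) + Complex.I * (((N : ℝ)⁻¹ ^ 2 : ℝ) : ℂ) := by
    rw [hτ]; push_cast; rfl
  have hτim : 0 < τ.im := by
    rw [hτ', Complex.add_im, Complex.I_mul_im, Complex.ofReal_im, Complex.ofReal_re, zero_add]
    positivity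
  have hs : Summable fun n : ℤ => Complex.exp (Real.pi * Complex.I * (n : ℂ) ^ 2 * τ) := by
    have := (hasSum_jacobiTheta₂_term 0 hτim).summable
    simpa [jacobiTheta₂_term] using this
  have hsI : ∀ z : ℂ, Summable fun n : ℤ => jacobiTheta₂_term n z Complex.I := fun z =>
    (hasSum_jacobiTheta₂_term z (by simp)).summable
  calc jacobiTheta τ
      = ∑' p : ℤ × Fin N, Complex.exp (Real.pi * Complex.I *
          (((Int.divModEquiv N).symm p : ℤ) : ℂ) ^ 2 * τ) :=
        ((Int.divModEquiv N).symm.tsum_eq _).symm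
    _ = ∑ r : Fin N, ∑' q : ℤ, Complex.exp (Real.pi * Complex.I *
          (((Int.divModEquiv N).symm (q, r) : ℤ) : ℂ) ^ 2 * τ) := by
        have hs' := (Int.divModEquiv N).symm.summable_iff.mpr hs
        refine hs'.tsum_prod.trans ?_
        simp only [tsum_fintype]
        refine Summable.tsum_finsetSum (f := fun (r : Fin N) (q : ℤ) => Complex.exp (Real.pi *
          Complex.I * (((Int.divModEquiv N).symm (q, r) : ℤ) : ℂ) ^ 2 * τ)) fun r _ => ?_
        exact hs'.comp_injective (i := fun q : ℤ => (q, r)) fun x y h => (Prod.ext_iff.mp h).1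
    _ = ∑ r : Fin N, gaussTerm N r * jacobiTheta₂ ((r : ℝ) / N : ℝ) Complex.I := by
        refine Finset.sum_congr rfl fun r _ => ?_
        rw [jacobiTheta₂_real_I, ← tsum_mul_left]
        refine tsum_congr fun q => ?_
        rw [gaussTerm, ← Complex.exp_add, Complex.exp_eq_exp_iff_exists_int]
        have e : (((Int.divModEquiv N).symm (q, r) : ℤ) : ℂ) = q * N + r := by
          simp [Int.divModEquiv]
        -- Only periodicity is used here, `u` being a dummy: the integer `v` extracted below
        -- measures in units of `2πi` the difference of the exponents at `r + Nq` and `r`.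
        obtain ⟨u, hu⟩ : ∃ u : ℤ, gaussTerm N (r + N * q) = gaussTerm N r ∧ u = 0 :=
          ⟨0, hp _ _, rfl⟩
        rw [gaussTerm, gaussTerm, Complex.exp_eq_exp_iff_exists_int] at hu
        obtain ⟨⟨v, hv⟩, -⟩ := hu
        refine ⟨v, ?_⟩
        rw [e, hτ]
        push_cast at hv ⊢
        field_simp at hv ⊢
        linear_combination N * Complex.I * hv + ((q * N + r) ^ 2 : ℂ) * Complex.I_sq
    _ = ∑ r : Fin N, ∑' n : ℤ, gaussTerm N (r + n) *
          Complex.exp (Real.pi * Complex.I * (n : ℂ) ^ 2 * (Complex.I - (N : ℂ)⁻¹)) := by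
        refine Finset.sum_congr rfl fun r _ => ?_
        rw [jacobiTheta₂, ← tsum_mul_left]
        refine tsum_congr fun n => ?_
        rw [gaussTerm, gaussTerm, jacobiTheta₂_term, ← Complex.exp_add, ← Complex.exp_add]
        congr 1
        push_cast
        field_simp
        ring
    _ = ∑' n : ℤ, ∑ r : Fin N, gaussTerm N (r + n) *
          Complex.exp (Real.pi * Complex.I * (n : ℂ) ^ 2 * (Complex.I - (N : ℂ)⁻¹)) := by
        refine (Summable.tsum_finsetSum fun r _ => ?_).symm
        refine ((hsI ((r : ℝ) / N : ℝ)).mul_left (gaussTerm N r)).congr fun n => ?_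
        rw [gaussTerm, gaussTerm, jacobiTheta₂_term, ← Complex.exp_add, ← Complex.exp_add]
        congr 1
        push_cast
        field_simp
        ring
    _ = _ := by
        rw [jacobiTheta, ← tsum_mul_left]
        refine tsum_congr fun n => ?_
        rw [← Finset.sum_mul, ← sum_zmod_val_add hp n,
          ← sum_fin_eq_sum_zmod_val (fun k : ℕ => gaussTerm N (k + n))]

/-- With `e = exp (-π Im τ) < 1/4`, the bound `2e / (1 - e)` on `‖θ(τ) - 1‖` is below 1. -/
lemma jacobiTheta_ne_zero_of_one_le_im {τ : ℂ} (hτ : 1 ≤ τ.im) : jacobiTheta τ ≠ 0 := by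
  intro h
  have h1 := norm_jacobiTheta_sub_one_le (lt_of_lt_of_le one_pos hτ)
  rw [h, zero_sub, norm_neg, norm_one] at h1
  set e := Real.exp (-Real.pi * τ.im)
  have he : e < 1 / 4 := by
    have h2 : e * Real.exp (Real.pi * τ.im) = 1 := by rw [← Real.exp_add]; simp
    have h3 : (3 : ℝ) + 1 ≤ Real.exp (Real.pi * τ.im) := by
      refine le_trans ?_ (Real.add_one_le_exp _)
      nlinarith [Real.pi_gt_three]
    have h4 : 0 < e := Real.exp_pos _
    have h5 : (4 : ℝ) < Real.exp (Real.pi * τ.im) := by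
      refine lt_of_lt_of_le ?_ (Real.add_one_le_exp _)
      nlinarith [Real.pi_gt_three]
    nlinarith
  rw [div_mul_eq_mul_div, le_div_iff₀ (by linarith)] at h1
  linarith

/-- In the right half-plane the two arguments have sum strictly between `-π` and `π`, so no branch
correction occurs. -/
lemma cpow_half_mul_cpow_half {z w : ℂ} (hz : 0 < z.re) (hw : 0 < w.re) :
    z ^ (1 / 2 : ℂ) * w ^ (1 / 2 : ℂ) = (z * w) ^ (1 / 2 : ℂ) := by
  have hz0 : z ≠ 0 := fun h => by simp [h] at hz
  have hw0 : w ≠ 0 := fun h => by simp [h] at hw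
  rw [Complex.cpow_def_of_ne_zero hz0, Complex.cpow_def_of_ne_zero hw0,
    Complex.cpow_def_of_ne_zero (mul_ne_zero hz0 hw0), ← Complex.exp_add, Complex.log_mul hz0 hw0,
    add_mul]
  have h1 := abs_lt.mp (Complex.abs_arg_lt_pi_div_two_iff.mpr (Or.inl hz))
  have h2 := abs_lt.mp (Complex.abs_arg_lt_pi_div_two_iff.mpr (Or.inl hw))
  exact ⟨by linarith, by linarith⟩

/-- The primitive eighth root of unity `exp (π i / 4)`. -/
noncomputable def zetaEight : ℂ := Complex.exp (Real.pi * Complex.I / 4)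

/-- The classical evaluation of the Gauss sum of even modulus: it is a positive multiple of the
primitive eighth root of unity. -/
theorem sum_gaussTerm_pos (a : ℕ) (ha : 0 < a) [NeZero (2 * a)] :
    ∃ c : ℝ, 0 < c ∧ ∑ x : ZMod (2 * a), gaussTerm (2 * a) x.val = c * zetaEight := by
  have hp : ∀ x y : ℤ, gaussTerm ((2 * a : ℕ) : ℤ) (x + (2 * a : ℕ) * y) =
      gaussTerm ((2 * a : ℕ) : ℤ) x := by
    intro x y
    push_cast
    exact gaussTerm_periodic (by exact_mod_cast ha.ne') x y
  have key := jacobiTheta_eq_gaussSum_mul hp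
  have hne : jacobiTheta (Complex.I - ((2 * a : ℕ) : ℂ)⁻¹) ≠ 0 := by
    apply jacobiTheta_ne_zero_of_one_le_im
    rw [show ((2 * a : ℕ) : ℂ)⁻¹ = (((2 * a : ℕ) : ℝ)⁻¹ : ℝ) by push_cast; rfl]
    simp
  set b : ℝ := ((2 * a : ℕ) : ℝ)⁻¹ with hb
  have hbpos : 0 < b := by rw [hb]; positivity
  have hab : 2 * (a : ℂ) * b = 1 := by
    rw [hb]; push_cast
    have : (a : ℂ) ≠ 0 := by exact_mod_cast ha.ne'
    field_simp
  rw [show ((2 * a : ℕ) : ℂ)⁻¹ = (b : ℂ) by rw [hb]; push_cast; rfl] at key hne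
  have hbC : (b : ℂ) ≠ 0 := by exact_mod_cast hbpos.ne'
  have hI : 1 + Complex.I * b ≠ 0 := by
    intro h; have := congrArg Complex.re h; simp at this
  set τ : ℂ := b + Complex.I * (b : ℂ) ^ 2 with hτ
  have hτeq : τ = b * (1 + Complex.I * b) := by rw [hτ]; ring
  have hτ0 : τ ≠ 0 := by rw [hτeq]; exact mul_ne_zero hbC hI
  have hθ : ∀ w : ℂ, jacobiTheta w = 1 / (-Complex.I * w) ^ (1 / 2 : ℂ) * jacobiTheta (-1 / w) := by
    intro w
    rw [jacobiTheta_eq_jacobiTheta₂, jacobiTheta_eq_jacobiTheta₂, jacobiTheta₂_functional_equation]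
    simp
  have hper : ∀ (j : ℕ) (w : ℂ), jacobiTheta (2 * j + w) = jacobiTheta w := by
    intro j
    induction j with
    | zero => simp
    | succ j ih =>
      intro w
      rw [show (2 * ((j + 1 : ℕ) : ℂ) + w) = 2 + (2 * j + w) by push_cast; ring,
        jacobiTheta_two_add, ih]
  -- A second route from `τ` to `I - b`: invert, translate by the even integer `2a = 1/b`, and
  -- invert again. The two square-root factors combine to that of `-I * b`, which carries the eighth
  -- root of unity.
  set τ' : ℂ := Complex.I / (1 + Complex.I * b) with hτ'
  have e1 : 2 * (a : ℂ) + -1 / τ = τ' := by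
    rw [hτ', hτeq]
    have hI' : 1 + b * Complex.I ≠ 0 := by rwa [mul_comm]
    field_simp
    linear_combination (1 + b * Complex.I) * hab
  have e2 : -1 / τ' = Complex.I - b := by
    rw [hτ']
    have := Complex.I_ne_zero
    field_simp
    linear_combination -Complex.I_sq
  have key2 : jacobiTheta τ = 1 / ((-Complex.I * τ) ^ (1 / 2 : ℂ) * (-Complex.I * τ') ^ (1 / 2 : ℂ))
      * jacobiTheta (Complex.I - b) := by
    rw [hθ τ, ← hper a (-1 / τ), e1, hθ τ', e2, ← mul_assoc]
    congr 1
    rw [div_mul_div_comm, one_mul]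
  have r1 : 0 < (-Complex.I * τ).re := by
    rw [hτ]
    simp [← Complex.ofReal_pow]
    positivity
  have r2 : 0 < (-Complex.I * τ').re := by
    rw [hτ', ← mul_div_assoc, show -Complex.I * Complex.I = 1 by simp, one_div, Complex.inv_re]
    simp only [Complex.add_re, Complex.one_re, Complex.I_mul_re, Complex.ofReal_im, neg_zero,
      add_zero]
    exact div_pos one_pos (Complex.normSq_pos.mpr hI)
  have e3 : -Complex.I * τ * (-Complex.I * τ') = b * (-Complex.I) := by
    rw [hτ', hτeq]
    field_simp
    linear_combination Complex.I_sq
  rw [cpow_half_mul_cpow_half r1 r2, e3, key] at key2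
  have key3 := mul_right_cancel₀ hne key2
  -- The positive factor is `b ^ (-1/2) = √(2a)`.
  refine ⟨Real.exp (-Real.log b / 2), Real.exp_pos _, ?_⟩
  push_cast at key3
  rw [key3, Complex.cpow_def_of_ne_zero (mul_ne_zero hbC (neg_ne_zero.mpr Complex.I_ne_zero)),
    Complex.log_ofReal_mul hbpos (neg_ne_zero.mpr Complex.I_ne_zero), Complex.log_neg_I, one_div,
    ← Complex.exp_neg, zetaEight, Complex.ofReal_exp, ← Complex.exp_add]
  congr 1
  push_cast
  ring

/-! ### Sums over finite abelian groups up to positive real factors -/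

/-- `s` is a positive real multiple of `t`. -/
def PosProportional (s t : ℂ) : Prop := ∃ c : ℝ, 0 < c ∧ s = c * t

namespace PosProportional

lemma refl (s : ℂ) : PosProportional s s := ⟨1, one_pos, by simp⟩

lemma symm {s t : ℂ} (h : PosProportional s t) : PosProportional t s := by
  obtain ⟨c, hc, rfl⟩ := h
  have : (c : ℂ) ≠ 0 := by exact_mod_cast hc.ne'
  exact ⟨c⁻¹, inv_pos.mpr hc, by push_cast; field_simp⟩

lemma trans {s t u : ℂ} (h : PosProportional s t) (h' : PosProportional t u) :
    PosProportional s u := by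
  obtain ⟨c, hc, rfl⟩ := h
  obtain ⟨c', hc', rfl⟩ := h'
  exact ⟨c * c', mul_pos hc hc', by push_cast; ring⟩

lemma prod {J : Type*} (S : Finset J) {s t : J → ℂ} (h : ∀ j, PosProportional (s j) (t j)) :
    PosProportional (∏ j ∈ S, s j) (∏ j ∈ S, t j) := by
  choose c hc h using h
  exact ⟨∏ j ∈ S, c j, Finset.prod_pos fun j _ => hc j, by
    push_cast; rw [← Finset.prod_mul_distrib]; exact Finset.prod_congr rfl fun j _ => h j⟩

lemma star {s t : ℂ} (h : PosProportional s t) :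
    PosProportional (starRingEnd ℂ s) (starRingEnd ℂ t) := by
  obtain ⟨c, hc, rfl⟩ := h
  exact ⟨c, hc, by simp⟩

end PosProportional

lemma sum_comp_surjective {A B : Type*} [AddGroup A] [AddGroup B] [Fintype A] [Fintype B]
    (p : A →+ B) (hp : Function.Surjective p) (F : B → ℂ) :
    PosProportional (∑ a, F (p a)) (∑ b, F b) := by
  classical
  refine ⟨((Finset.univ.filter fun a => p a = 0).card : ℝ), ?_, ?_⟩
  · exact_mod_cast Finset.card_pos.mpr ⟨0, by simp⟩
  · rw [← Finset.sum_fiberwise (s := Finset.univ) (g := p), Finset.mul_sum]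
    refine Finset.sum_congr rfl fun b _ => ?_
    rw [Finset.sum_congr rfl (g := fun _ => F b)
      (fun a ha => by rw [(Finset.mem_filter.mp ha).2]), Finset.sum_const, nsmul_eq_mul]
    have := AddMonoidHom.card_fiber_eq_of_mem_range p (x := b) (y := 0) (hp b) (hp 0)
    rw [this]
    push_cast
    rfl

/-- `X` may be infinite, so the comparison is made over its finite joint image in `G × G'`. This
image maps onto both groups with fibres of constant size. -/
lemma sum_posProportional_of_comp_eq {X G G' : Type*} [AddGroup X] [AddGroup G] [AddGroup G']
    [Fintype G] [Fintype G'] (p : X →+ G) (hp : Function.Surjective p) (p' : X →+ G')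
    (hp' : Function.Surjective p') (F : G → ℂ) (F' : G' → ℂ) (h : ∀ x, F (p x) = F' (p' x)) :
    PosProportional (∑ g, F g) (∑ g, F' g) := by
  classical
  let R := (p.prod p').range
  have : Fintype R := Fintype.ofFinite R
  have h1 := sum_comp_surjective ((AddMonoidHom.fst G G').comp R.subtype)
    (fun g => by
      obtain ⟨x, rfl⟩ := hp g
      exact ⟨⟨_, x, rfl⟩, rfl⟩) F
  have h2 := sum_comp_surjective ((AddMonoidHom.snd G G').comp R.subtype)
    (fun g => by
      obtain ⟨x, rfl⟩ := hp' g
      exact ⟨⟨_, x, rfl⟩, rfl⟩) F'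
  refine h1.symm.trans (PosProportional.trans ?_ h2)
  rw [Finset.sum_congr rfl (g := fun r : R => F' (((AddMonoidHom.snd G G').comp R.subtype) r))]
  · exact PosProportional.refl _
  · rintro ⟨_, x, rfl⟩ -
    exact h x

/-- The sum of a quadratic function over a finite abelian group is concentrated on the elements
translation by which along a subgroup is trivial. -/
lemma sum_eq_sum_filter_invariant {G : Type*} [AddCommGroup G] [Fintype G] (H : AddSubgroup G)
    (f : G → ℂ) (hf : ∀ x, f x ≠ 0)
    (hmul : ∀ x, ∀ h ∈ H, ∀ h' ∈ H, f (x + (h + h')) * f x = f (x + h) * f (x + h'))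
    [DecidablePred fun x => ∀ h ∈ H, f (x + h) = f x] :
    ∑ x, f x = ∑ x with ∀ h ∈ H, f (x + h) = f x, f x := by
  classical
  have : Fintype H := Fintype.ofFinite H
  let ψ : G → AddChar H ℂ := fun x =>
    { toFun := fun h => f (x + h) / f x
      map_zero_eq_one' := by simp [hf x]
      map_add_eq_mul' := fun h h' => by
        have := hmul x h h.2 h' h'.2
        field_simp [hf x]
        push_cast
        rw [← this] }
  -- The zero of the additive group of characters is the trivial character. Only trivial characters
  -- have a nonzero sum over `H`.
  have hψ : ∀ x, ψ x = 0 ↔ ∀ h ∈ H, f (x + h) = f x := fun x => by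
    rw [AddChar.eq_zero_iff]
    constructor
    · intro h a ha
      exact (div_eq_one_iff_eq (hf x)).mp (h ⟨a, ha⟩)
    · intro h a
      exact (div_eq_one_iff_eq (hf x)).mpr (h a a.2)
  have key : (Fintype.card H : ℂ) * ∑ x, f x =
      (Fintype.card H : ℂ) * ∑ x with ∀ h ∈ H, f (x + h) = f x, f x := by
    calc (Fintype.card H : ℂ) * ∑ x, f x = ∑ h : H, ∑ x, f (x + h) := by
          rw [Fintype.sum_congr (fun h : H => ∑ x, f (x + h)) (fun _ => ∑ x, f x)
            (fun h => Equiv.sum_comp (Equiv.addRight (h : G)) f)]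
          simp
      _ = ∑ x, f x * ∑ h : H, ψ x h := by
          rw [Finset.sum_comm]
          refine Finset.sum_congr rfl fun x _ => ?_
          rw [Finset.mul_sum]
          refine Finset.sum_congr rfl fun h _ => ?_
          exact (mul_div_cancel₀ _ (hf x)).symm
      _ = _ := by
          rw [Finset.mul_sum, Finset.sum_filter]
          refine Finset.sum_congr rfl fun x _ => ?_
          rw [AddChar.sum_eq_ite]
          simp only [hψ, mul_ite, mul_zero]
          split_ifs <;> ring
  exact mul_left_cancel₀ (by exact_mod_cast Fintype.card_ne_zero) key

/-- The reduction mechanism used twice below: for `H` an isotropic subgroup and `q.range` its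
orthogonal complement, a Gauss sum on `G` reduces to one on the smaller group `G'`. -/
lemma sum_posProportional_of_isotropic {X G G' : Type*} [AddCommGroup X] [AddCommGroup G]
    [AddCommGroup G'] [Fintype G] [Fintype G'] (H : AddSubgroup G)
    (f : G → ℂ) (hf : ∀ x, f x ≠ 0)
    (hmul : ∀ x, ∀ h ∈ H, ∀ h' ∈ H, f (x + (h + h')) * f x = f (x + h) * f (x + h'))
    (q : X →+ G) (hq : ∀ x, (∀ h ∈ H, f (x + h) = f x) ↔ x ∈ q.range)
    (p : X →+ G') (hp : Function.Surjective p) (F : G' → ℂ) (h : ∀ x, f (q x) = F (p x)) :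
    PosProportional (∑ g, f g) (∑ g, F g) := by
  classical
  rw [sum_eq_sum_filter_invariant H f hf hmul]
  have : Fintype q.range := Fintype.ofFinite _
  have e : ∑ x with ∀ h ∈ H, f (x + h) = f x, f x = ∑ x : q.range, f x := by
    refine Finset.sum_subtype _ (fun x => ?_) f
    rw [Finset.mem_filter, hq]
    simp
  rw [e]
  exact sum_posProportional_of_comp_eq q.rangeRestrict q.rangeRestrict_surjective p hp
    (fun x : q.range => f x) F h

/-! ### Gauss sums of nonsingular integral forms -/

/-- The character `t ↦ exp (2 π i t)` of the rational numbers. -/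
noncomputable def ratChar (t : ℚ) : ℂ := Complex.exp (2 * Real.pi * Complex.I * t)

lemma ratChar_add (s t : ℚ) : ratChar (s + t) = ratChar s * ratChar t := by
  rw [ratChar, ratChar, ratChar, ← Complex.exp_add]
  push_cast
  ring_nf

lemma ratChar_ne_zero (t : ℚ) : ratChar t ≠ 0 := Complex.exp_ne_zero _

lemma ratChar_zero : ratChar 0 = 1 := by simp [ratChar]

lemma ratChar_eq_one_iff (t : ℚ) : ratChar t = 1 ↔ ∃ n : ℤ, t = n := by
  rw [ratChar, Complex.exp_eq_one_iff]
  refine exists_congr fun n => ?_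
  have := Complex.two_pi_I_ne_zero
  rw [mul_comm, mul_left_inj' this]
  norm_cast

lemma ratChar_eq_iff (s t : ℚ) : ratChar s = ratChar t ↔ ∃ n : ℤ, s = t + n := by
  have h : ratChar s = ratChar (s - t) * ratChar t := by rw [← ratChar_add]; ring_nf
  rw [h, mul_eq_right₀ (ratChar_ne_zero t), ratChar_eq_one_iff]
  exact exists_congr fun n => by rw [sub_eq_iff_eq_add, add_comm]

lemma ratChar_sum {J : Type*} (S : Finset J) (t : J → ℚ) :
    ratChar (∑ j ∈ S, t j) = ∏ j ∈ S, ratChar (t j) := by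
  classical
  induction S using Finset.induction_on with
  | empty => simp [ratChar_zero]
  | insert j S hj ih => rw [Finset.sum_insert hj, Finset.prod_insert hj, ratChar_add, ih]

lemma gaussTerm_eq_ratChar (a x : ℤ) : gaussTerm (2 * a) x = ratChar ((x : ℚ) ^ 2 / (4 * a)) := by
  rw [gaussTerm, ratChar]
  congr 1
  push_cast
  by_cases ha : (a : ℂ) = 0
  · simp [ha]
  · field_simp
    ring

/-- Negative `a` is reduced to `-a` by complex conjugation, which inverts `zetaEight`. -/
theorem sum_gaussTerm_sign (a : ℤ) (ha : a ≠ 0) [NeZero (2 * a.natAbs)] :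
    PosProportional (∑ x : ZMod (2 * a.natAbs), gaussTerm (2 * a) x.val)
      (zetaEight ^ (SignType.sign a : ℤ)) := by
  have hpos : 0 < a.natAbs := Int.natAbs_pos.mpr ha
  have h := sum_gaussTerm_pos a.natAbs hpos
  rcases lt_or_gt_of_ne ha with h0 | h0
  · have e : ((a.natAbs : ℕ) : ℤ) = -a := Int.ofNat_natAbs_of_nonpos h0.le
    rw [e] at h
    have h' := PosProportional.star h
    rw [sign_neg h0]
    convert h' using 1
    · rw [map_sum]
      refine Finset.sum_congr rfl fun x _ => ?_
      rw [gaussTerm, gaussTerm, ← Complex.exp_conj]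
      congr 1
      simp only [map_mul, map_div₀, map_pow, Complex.conj_ofReal, Complex.conj_I, map_intCast]
      push_cast
      ring
    · simp only [SignType.coe_neg_one, zpow_neg_one]
      rw [zetaEight, ← Complex.exp_conj, ← Complex.exp_neg]
      congr 1
      simp only [map_mul, map_div₀, Complex.conj_ofReal, Complex.conj_I, map_ofNat]
      ring
  · have e : ((a.natAbs : ℕ) : ℤ) = a := Int.natAbs_of_nonneg h0.le
    rw [e] at h
    rw [sign_pos h0]
    obtain ⟨c, hc, h⟩ := h
    exact ⟨c, hc, by rw [h]; simp⟩

/-- A functional with integral values on a form nonsingular modulo its radical, written in terms of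
a rational diagonalisation, is represented by an element. -/
lemma exists_pairing_eq {Z J : Type*} [AddCommGroup Z] [Fintype J] (Q : Z →+ Z →+ ℤ) (v : J → Z)
    (a : J → ℤ) (ha : ∀ j, a j ≠ 0)
    (hortho : ∀ i j, i ≠ j → Q (v i) (v j) = 0) (hdiag : ∀ j, Q (v j) (v j) = a j)
    (hQ : ∀ z w, (Q z w : ℚ) = ∑ j, (Q z (v j) : ℚ) * Q w (v j) / a j)
    (hU : ∀ (g : Z →+ ℤ) (N : ℤ) (w : Z), N ≠ 0 → (∀ z, N * g z = Q z w) →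
      ∃ m, ∀ z, g z = Q z m)
    (x : J → ℤ) (h1 : ∀ z, ∃ n : ℤ, ∑ j, (x j : ℚ) * Q z (v j) / a j = n) :
    ∃ m, ∀ j, Q m (v j) = x j := by
  classical
  have haQ : ∀ j, (a j : ℚ) ≠ 0 := fun j => by exact_mod_cast ha j
  choose g hg using h1
  let g' : Z →+ ℤ :=
    { toFun := g
      map_zero' := by
        have := hg 0
        simp at this
        exact_mod_cast this.symm
      map_add' := fun z w => by
        have := hg (z + w)
        have h3 : ((g (z + w) : ℤ) : ℚ) = (g z + g w : ℤ) := by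
          push_cast
          rw [← hg, ← hg, ← hg, ← Finset.sum_add_distrib]
          refine Finset.sum_congr rfl fun j _ => ?_
          simp
          ring
        exact_mod_cast h3 }
  -- Over ℚ the functional is represented by the sum of `(x j / a j) • v j`. Multiplying by the
  -- product of all `a j` makes this vector integral, as `hU` requires.
  obtain ⟨m, hm⟩ := hU g' (∏ j, a j) (∑ j, (x j * ∏ i ∈ Finset.univ.erase j, a i) • v j)
    (Finset.prod_ne_zero_iff.mpr fun j _ => ha j) (fun z => by
      have h4 : (((∏ j, a j) * g z : ℤ) : ℚ) =
          ((Q z (∑ j, (x j * ∏ i ∈ Finset.univ.erase j, a i) • v j) : ℤ) : ℚ) := by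
        rw [map_sum]
        push_cast
        rw [← hg, Finset.mul_sum]
        refine Finset.sum_congr rfl fun j _ => ?_
        rw [map_zsmul, ← Finset.mul_prod_erase _ _ (Finset.mem_univ j)]
        have := haQ j
        rw [smul_eq_mul]
        push_cast
        field_simp
      exact_mod_cast h4)
  refine ⟨m, fun j => ?_⟩
  have h5 : (Q m (v j) : ℚ) = Q (v j) m := by
    rw [hQ m, hQ (v j)]
    exact Finset.sum_congr rfl fun i _ => by ring
  have h6 : (g (v j) : ℚ) = x j := by
    rw [← hg, Finset.sum_eq_single j]
    · rw [hdiag]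
      have := haQ j
      field_simp
    · intro i _ hi
      rw [hortho j i (Ne.symm hi)]
      simp
    · simp
  have h7 : (Q (v j) m : ℚ) = g (v j) := by exact_mod_cast (hm (v j)).symm
  exact_mod_cast h5.trans (h7.trans h6)

/-- The Gauss sum of a symmetric bilinear form over `ℤ` which is nonsingular modulo its radical,
diagonalised over `ℚ` with the entries `a j`: its phase is the signature modulo 8. -/
theorem gaussSum_phase_of_nonsingular {Z J G : Type*} [AddCommGroup Z] [Fintype J] [AddCommGroup G]
    [Fintype G] (Q : Z →+ Z →+ ℤ) (v : J → Z) (a : J → ℤ)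
    (ha : ∀ j, a j ≠ 0)
    (hortho : ∀ i j, i ≠ j → Q (v i) (v j) = 0) (hdiag : ∀ j, Q (v j) (v j) = a j)
    (hQ : ∀ z w, (Q z w : ℚ) = ∑ j, (Q z (v j) : ℚ) * Q w (v j) / a j)
    (hU : ∀ (g : Z →+ ℤ) (N : ℤ) (w : Z), N ≠ 0 → (∀ z, N * g z = Q z w) →
      ∃ m, ∀ z, g z = Q z m)
    (p : Z →+ G) (hp : Function.Surjective p) (F : G → ℂ)
    (hF : ∀ z, F (p z) = ratChar ((Q z z : ℚ) / 4)) :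
    PosProportional (∑ g, F g) (zetaEight ^ (∑ j, (SignType.sign (a j) : ℤ))) := by
  classical
  have : ∀ j, NeZero (2 * (a j).natAbs) := fun j =>
    ⟨mul_ne_zero two_ne_zero (Int.natAbs_ne_zero.mpr (ha j))⟩
  have haQ : ∀ j, (a j : ℚ) ≠ 0 := fun j => by exact_mod_cast ha j
  -- An integer vector `x` stands for the sum of `(x j / a j) • v j` in the dual of the diagonal
  -- lattice. `L` embeds the form modulo its radical in this dual lattice, and `f` extends its Gauss
  -- terms.
  let c : (J → ℤ) →+ (∀ j, ZMod (2 * (a j).natAbs)) :=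
    { toFun := fun x j => (x j : ZMod _)
      map_zero' := by ext; simp
      map_add' := fun x y => by ext; simp }
  let L : Z →+ (J → ℤ) :=
    { toFun := fun z j => Q z (v j)
      map_zero' := by ext; simp
      map_add' := fun x y => by ext; simp }
  let f : (∀ j, ZMod (2 * (a j).natAbs)) → ℂ := fun x => ∏ j, gaussTerm (2 * a j) (x j).val
  have hc : Function.Surjective c := fun x =>
    ⟨fun j => (x j).val, funext fun j => by simp [c]⟩
  have hfc : ∀ x, f (c x) = ratChar (∑ j, (x j : ℚ) ^ 2 / (4 * a j)) := by
    intro x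
    rw [ratChar_sum]
    refine Finset.prod_congr rfl fun j _ => ?_
    rw [← gaussTerm_eq_ratChar]
    refine periodic_intCast_val (h := gaussTerm (2 * a j)) (fun x y => ?_) (x j)
    rcases Int.natAbs_eq (a j) with h | h
    · have : ((2 * (a j).natAbs : ℕ) : ℤ) = 2 * a j := by
        rw [Nat.cast_mul, ← h]
        rfl
      rw [this, gaussTerm_periodic (ha j)]
    · have : ((2 * (a j).natAbs : ℕ) : ℤ) * y = 2 * a j * (-y) := by
        have h' : ((a j).natAbs : ℤ) = -a j := by omega
        rw [Nat.cast_mul, h']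
        push_cast
        ring
      rw [this, gaussTerm_periodic (ha j)]
  have hfL : ∀ z, f (c (L z)) = ratChar ((Q z z : ℚ) / 4) := by
    intro z
    rw [hfc, hQ z z, Finset.sum_div]
    congr 1
    refine Finset.sum_congr rfl fun j _ => ?_
    simp only [L, AddMonoidHom.coe_mk, ZeroHom.coe_mk]
    have := haQ j
    field_simp
  have hshift : ∀ x z, f (c x + c (2 • L z)) = f (c x) * ratChar (∑ j, (x j : ℚ) * Q z (v j) / a j) := by
    intro x z
    -- The shift by `2 • L z` produces the quadratic term `4 * Q z z / 4`, an integer that the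
    -- character does not see.
    have h1 : ratChar (Q z z : ℚ) = 1 := (ratChar_eq_one_iff _).mpr ⟨_, rfl⟩
    rw [← map_add, hfc, hfc, ← ratChar_add, ← mul_one (ratChar (_ + _)), ← h1, ← ratChar_add, hQ z z,
      ← Finset.sum_add_distrib, ← Finset.sum_add_distrib]
    congr 1
    refine Finset.sum_congr rfl fun j _ => ?_
    have := haQ j
    simp [L]
    field_simp
    ring
  have hsum : PosProportional (∑ x, f x) (zetaEight ^ (∑ j, (SignType.sign (a j) : ℤ))) := by
    have e1 : ∑ x, f x = ∏ j, ∑ y : ZMod (2 * (a j).natAbs), gaussTerm (2 * a j) y.val := by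
      rw [Finset.prod_univ_sum, Fintype.piFinset_univ]
    have hz : zetaEight ≠ 0 := Complex.exp_ne_zero _
    have e2 : zetaEight ^ (∑ j, (SignType.sign (a j) : ℤ)) =
        ∏ j, zetaEight ^ (SignType.sign (a j) : ℤ) := by
      induction (Finset.univ : Finset J) using Finset.induction_on with
      | empty => simp
      | insert j S hj ih => rw [Finset.sum_insert hj, Finset.prod_insert hj, zpow_add₀ hz, ih]
    rw [e1, e2]
    exact PosProportional.prod _ fun j => sum_gaussTerm_sign (a j) (ha j)
  refine PosProportional.trans (PosProportional.symm ?_) hsum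
  -- The isotropic subgroup is the image of twice the lattice. By unimodularity modulo the radical,
  -- its orthogonal complement is the image of the lattice itself.
  refine sum_posProportional_of_isotropic (c.comp (2 • L)).range f
    (fun x => Finset.prod_ne_zero_iff.mpr fun j _ => Complex.exp_ne_zero _) ?_ (c.comp L) ?_ p hp F
    (fun z => by rw [hF]; exact hfL z)
  · rintro x _ ⟨z, rfl⟩ _ ⟨w, rfl⟩
    obtain ⟨x, rfl⟩ := hc x
    have e : ∀ z, (c.comp (2 • L)) z = c (2 • L z) := fun z => rfl
    rw [← map_add, e, e, e, hshift, hshift, hshift]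
    have : ratChar (∑ j, (x j : ℚ) * Q (z + w) (v j) / a j) =
        ratChar (∑ j, (x j : ℚ) * Q z (v j) / a j) * ratChar (∑ j, (x j : ℚ) * Q w (v j) / a j) := by
      rw [← ratChar_add, ← Finset.sum_add_distrib]
      congr 1
      refine Finset.sum_congr rfl fun j _ => ?_
      simp
      ring
    rw [this]
    ring
  · intro x
    obtain ⟨x, rfl⟩ := hc x
    constructor
    · intro h
      have h1 : ∀ z, ∃ n : ℤ, ∑ j, (x j : ℚ) * Q z (v j) / a j = n := by
        intro z
        have h2 := h (c (2 • L z)) ⟨z, rfl⟩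
        rw [hshift] at h2
        rw [← ratChar_eq_one_iff]
        exact (mul_eq_left₀ (Finset.prod_ne_zero_iff.mpr fun j _ => Complex.exp_ne_zero _)).mp h2
      obtain ⟨m, hm⟩ := exists_pairing_eq Q v a ha hortho hdiag hQ hU x h1
      exact ⟨m, congrArg c (funext hm)⟩
    · rintro ⟨m, hm⟩ _ ⟨z, rfl⟩
      change c (L m) = c x at hm
      rw [← hm]
      have e : (c.comp (2 • L)) z = c (2 • L z) := rfl
      rw [e, hshift, (ratChar_eq_one_iff _).mpr, mul_one]
      exact ⟨Q m z, by rw [hQ]; rfl⟩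

/-! ### The Gauss sum of a complex modulo 4 -/

/-- The character `t ↦ i ^ t` of `ℤ/4`. -/
noncomputable def modFourChar (t : ZMod 4) : ℂ := ratChar ((t.val : ℚ) / 4)

lemma ratChar_div_four_eq {x y : ℤ} (h : ∃ t, x = y + 4 * t) :
    ratChar ((x : ℚ) / 4) = ratChar ((y : ℚ) / 4) := by
  obtain ⟨t, rfl⟩ := h
  rw [ratChar_eq_iff]
  exact ⟨t, by push_cast; ring⟩

lemma modFourChar_intCast (x : ℤ) : modFourChar (x : ZMod 4) = ratChar ((x : ℚ) / 4) := by
  have h := periodic_intCast_val (N := 4) (h := fun x : ℤ => ratChar ((x : ℚ) / 4))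
    (fun x y => ratChar_div_four_eq ⟨y, rfl⟩) x
  rw [← h]
  simp [modFourChar]

/-- The sum of `i ^ (x φ x)` over the kernel of `d` modulo 4. -/
noncomputable def gaussSumModFour {I I' : Type*} [Fintype I]
    (d : Matrix I' I (ZMod 4)) (φ : Matrix I I (ZMod 4)) : ℂ :=
  letI : Fintype (LinearMap.ker d.mulVecLin) := Fintype.ofFinite _
  ∑ x : LinearMap.ker d.mulVecLin, modFourChar ((x : I → ZMod 4) ⬝ᵥ φ *ᵥ x)

/-- The form on integral cocycles. -/
def cocyclePairing {I₁ I₂ : Type*} [Fintype I₁] (d₂ : Matrix I₂ I₁ ℤ) (φ : Matrix I₁ I₁ ℤ) :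
    LinearMap.ker d₂.mulVecLin →+ LinearMap.ker d₂.mulVecLin →+ ℤ :=
  AddMonoidHom.mk' (fun z => AddMonoidHom.mk' (fun w => (z : I₁ → ℤ) ⬝ᵥ φ *ᵥ w)
      fun w w' => by simp [Matrix.mulVec_add])
    fun z z' => by ext w; simp

lemma cocyclePairing_apply {I₁ I₂ : Type*} [Fintype I₁] {d₂ : Matrix I₂ I₁ ℤ}
    {φ : Matrix I₁ I₁ ℤ} (z w : LinearMap.ker d₂.mulVecLin) :
    cocyclePairing d₂ φ z w = (z : I₁ → ℤ) ⬝ᵥ φ *ᵥ w := rfl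

lemma intCast_mulVec {I J : Type*} [Fintype J] (R : Type*) [CommRing R] (M : Matrix I J ℤ)
    (x : J → ℤ) : (fun i => ((M *ᵥ x) i : R)) = M.map (Int.cast : ℤ → R) *ᵥ (fun j => (x j : R)) := by
  ext i
  simp [Matrix.mulVec, dotProduct]

lemma intCast_dotProduct {J : Type*} [Fintype J] (R : Type*) [CommRing R] (x y : J → ℤ) :
    ((x ⬝ᵥ y : ℤ) : R) = (fun j => (x j : R)) ⬝ᵥ (fun j => (y j : R)) := by
  simp [dotProduct]

lemma intCast_pairing {J : Type*} [Fintype J] (R : Type*) [CommRing R] (M : Matrix J J ℤ)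
    (x y : J → ℤ) : ((x ⬝ᵥ M *ᵥ y : ℤ) : R) =
      (fun j => (x j : R)) ⬝ᵥ M.map (Int.cast : ℤ → R) *ᵥ (fun j => (y j : R)) := by
  rw [intCast_dotProduct, intCast_mulVec]

/-- The part of the data of a symmetric Poincaré complex over `ℤ` around the middle dimension which
determines its signature modulo 8. -/
structure MiddleDuality {I₀ I₁ I₂ : Type*} [Fintype I₀] [Fintype I₁] [Fintype I₂]
    (d₁ : Matrix I₁ I₀ ℤ) (d₂ : Matrix I₂ I₁ ℤ) (φ : Matrix I₁ I₁ ℤ) : Prop where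
  d_comp_d : d₂ * d₁ = 0
  left : ∃ ψ : Matrix I₀ I₂ ℤ, d₁ᵀ * φ = ψ * d₂
  symm : ∃ (ψ : Matrix I₁ I₂ ℤ) (ψ' : Matrix I₂ I₁ ℤ), φ - φᵀ = ψ * d₂ + d₂ᵀ * ψ'
  -- Here `d₂ *ᵥ x` is a coboundary and `u ᵥ* d₁` a boundary. The second clause is injectivity of
  -- duality one degree above the middle, on classes killed by 2.
  right : ∃ φ' : Matrix I₂ I₀ ℤ, φ * d₁ = d₂ᵀ * φ' ∧ ∀ x y, d₂ *ᵥ x = (2 : ℤ) • y →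
    (∃ u, y ᵥ* φ' = u ᵥ* d₁) → ∃ w, d₂ *ᵥ w = y
  -- Duality is onto middle homology: every cycle is homologous to the dual of a cocycle.
  surj : ∀ c, c ᵥ* d₁ = 0 → ∃ z u, d₂ *ᵥ z = 0 ∧ c = z ᵥ* φ + u ᵥ* d₂

namespace MiddleDuality

variable {I₀ I₁ I₂ : Type*} [Fintype I₀] [Fintype I₁] [Fintype I₂]
  {d₁ : Matrix I₁ I₀ ℤ} {d₂ : Matrix I₂ I₁ ℤ} {φ : Matrix I₁ I₁ ℤ}

/-- The cochains which vanish on all cycles; these are the cocycles of finite order in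
cohomology. -/
def torsionCocycles (d₁ : Matrix I₁ I₀ ℤ) : AddSubgroup (I₁ → ℤ) where
  carrier := {b | ∀ u, u ᵥ* d₁ = 0 → u ⬝ᵥ b = 0}
  zero_mem' u _ := by simp
  add_mem' {b c} hb hc u hu := by rw [dotProduct_add, hb u hu, hc u hu, add_zero]
  neg_mem' {b} hb u hu := by rw [dotProduct_neg, hb u hu, neg_zero]

lemma cocycle_of_torsionCocycles (h : MiddleDuality d₁ d₂ φ) {b : I₁ → ℤ}
    (hb : b ∈ torsionCocycles d₁) : d₂ *ᵥ b = 0 := by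
  classical
  ext i
  have h1 := hb (Pi.single i 1 ᵥ* d₂) (by rw [Matrix.vecMul_vecMul, h.d_comp_d, Matrix.vecMul_zero])
  rw [← Matrix.dotProduct_mulVec] at h1
  simpa using h1

/-- `z ᵥ* φ` is a cycle when `z` is a cocycle, and torsion cocycles vanish on cycles. -/
lemma pairing_torsionCocycles (h : MiddleDuality d₁ d₂ φ) {z b : I₁ → ℤ} (hz : d₂ *ᵥ z = 0)
    (hb : b ∈ torsionCocycles d₁) : z ⬝ᵥ φ *ᵥ b = 0 := by
  obtain ⟨φ', hφ', -⟩ := h.right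
  rw [Matrix.dotProduct_mulVec]
  apply hb
  rw [Matrix.vecMul_vecMul, hφ', ← Matrix.vecMul_vecMul, Matrix.vecMul_transpose, hz,
    Matrix.zero_vecMul]

/-- The error terms keep the coboundaries explicit, so that they can be reduced when `x` or `y` is a
cocycle only modulo 2 or 4. -/
lemma pairing_comm (h : MiddleDuality d₁ d₂ φ) : ∃ ψ : Matrix I₁ I₂ ℤ, ∃ ψ' : Matrix I₂ I₁ ℤ,
    ∀ x y, x ⬝ᵥ φ *ᵥ y = y ⬝ᵥ φ *ᵥ x + x ⬝ᵥ ψ *ᵥ (d₂ *ᵥ y) + (d₂ *ᵥ x) ⬝ᵥ ψ' *ᵥ y := by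
  obtain ⟨ψ, ψ', h1⟩ := h.symm
  refine ⟨ψ, ψ', fun x y => ?_⟩
  have h2 : φ = φᵀ + (ψ * d₂ + d₂ᵀ * ψ') := by rw [← h1]; abel
  have h3 : y ⬝ᵥ φ *ᵥ x = x ⬝ᵥ φᵀ *ᵥ y := by
    rw [Matrix.mulVec_transpose, Matrix.dotProduct_mulVec, dotProduct_comm]
  rw [h3]
  conv_lhs => rw [h2]
  rw [Matrix.add_mulVec, Matrix.add_mulVec, ← Matrix.mulVec_mulVec, ← Matrix.mulVec_mulVec,
    dotProduct_add, dotProduct_add, Matrix.dotProduct_mulVec x d₂ᵀ, Matrix.vecMul_transpose]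
  ring

lemma pairing_symm (h : MiddleDuality d₁ d₂ φ) {z w : I₁ → ℤ} (hz : d₂ *ᵥ z = 0)
    (hw : d₂ *ᵥ w = 0) : z ⬝ᵥ φ *ᵥ w = w ⬝ᵥ φ *ᵥ z := by
  obtain ⟨ψ, ψ', h1⟩ := h.pairing_comm
  rw [h1, hz, hw]
  simp

/-- Nonsingularity of the linking form, in the form in which it is used: a cochain which is a cocycle
modulo 2, and which pairs evenly with the torsion cocycles, lifts modulo 2 to a cocycle. -/
lemma exists_coboundary_eq (h : MiddleDuality d₁ d₂ φ) {x : I₁ → ℤ} {y : I₂ → ℤ}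
    (hxy : d₂ *ᵥ x = (2 : ℤ) • y) (hx : ∀ b ∈ torsionCocycles d₁, Even (x ⬝ᵥ φ *ᵥ b)) :
    ∃ w, d₂ *ᵥ w = y := by
  classical
  obtain ⟨φ', hφ', h1⟩ := h.right
  refine h1 x y hxy ?_
  set ρ := d₁.vecMulLinear with hρ
  -- The group of boundaries is free. Each coordinate on it, pulled back to chains, vanishes on
  -- cycles and is therefore a torsion cocycle, so the hypothesis makes the boundary of `x ᵥ* φ`
  -- twice a boundary.
  let β := Module.Free.chooseBasis ℤ (LinearMap.range ρ)
  have hcoord : ∀ i, Even (β.repr (ρ.rangeRestrict (x ᵥ* φ)) i) := by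
    intro i
    let f : (I₁ → ℤ) →ₗ[ℤ] ℤ := (β.coord i).comp ρ.rangeRestrict
    have hf : ∀ u, f u = u ⬝ᵥ (fun j => f (Pi.single j 1)) := by
      intro u
      conv_lhs => rw [pi_eq_sum_univ' u]
      rw [map_sum, dotProduct]
      refine Finset.sum_congr rfl fun j _ => ?_
      rw [← smul_eq_mul, ← map_smul]
    have hb : (fun j => f (Pi.single j 1)) ∈ torsionCocycles d₁ := by
      intro u hu
      rw [← hf]
      have : ρ.rangeRestrict u = 0 := Subtype.ext hu
      simp only [f, LinearMap.comp_apply, this, map_zero]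
    have := hx _ hb
    rwa [Matrix.dotProduct_mulVec, ← hf] at this
  choose g hg using hcoord
  have e : ρ.rangeRestrict (x ᵥ* φ) = (2 : ℤ) • ∑ i, g i • β i := by
    rw [← β.sum_repr (ρ.rangeRestrict (x ᵥ* φ)), Finset.smul_sum]
    refine Finset.sum_congr rfl fun i _ => ?_
    rw [hg, smul_smul, two_mul]
  obtain ⟨u, hu⟩ := (∑ i, g i • β i).2
  refine ⟨u, ?_⟩
  have e1 : (2 : ℤ) • (y ᵥ* φ') = (2 : ℤ) • (u ᵥ* d₁) := by
    calc (2 : ℤ) • (y ᵥ* φ') = ((2 : ℤ) • y) ᵥ* φ' := by rw [Matrix.smul_vecMul]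
      _ = (x ᵥ* φ) ᵥ* d₁ := by
        rw [← hxy, ← Matrix.vecMul_transpose, Matrix.vecMul_vecMul, ← hφ', Matrix.vecMul_vecMul]
      _ = _ := (congrArg Subtype.val e).trans (by
        rw [Submodule.coe_smul, ← hu]
        rfl)
  exact smul_right_injective _ (two_ne_zero : (2 : ℤ) ≠ 0) e1

/-- Unimodularity modulo the radical: `g` extends to a functional on all cochains, that is, to a
chain. This chain is a cycle because `N * g` vanishes on coboundaries, and by `surj` it is dual to a
cocycle up to a boundary. -/
lemma exists_represents (h : MiddleDuality d₁ d₂ φ) (g : LinearMap.ker d₂.mulVecLin →+ ℤ) (N : ℤ)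
    (w : LinearMap.ker d₂.mulVecLin) (hN : N ≠ 0)
    (hg : ∀ z, N * g z = (z : I₁ → ℤ) ⬝ᵥ φ *ᵥ w) :
    ∃ m : LinearMap.ker d₂.mulVecLin, ∀ z, g z = (z : I₁ → ℤ) ⬝ᵥ φ *ᵥ m := by
  classical
  -- The image of `d₂` is projective, being a subgroup of a free group, so the cocycles are a direct
  -- summand of the cochains and `r` below is a retraction onto them.
  obtain ⟨s, hs⟩ := Module.projective_lifting_property (d₂.mulVecLin.rangeRestrict) LinearMap.id
    d₂.mulVecLin.surjective_rangeRestrict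
  have hs' : ∀ x, d₂ *ᵥ (x - s (d₂.mulVecLin.rangeRestrict x)) = 0 := by
    intro x
    have := congrArg Subtype.val (LinearMap.congr_fun hs (d₂.mulVecLin.rangeRestrict x))
    rw [Matrix.mulVec_sub, sub_eq_zero]
    exact this.symm
  let r : (I₁ → ℤ) →ₗ[ℤ] LinearMap.ker d₂.mulVecLin :=
    LinearMap.codRestrict _ (LinearMap.id - s.comp d₂.mulVecLin.rangeRestrict) hs'
  have hr : ∀ z : LinearMap.ker d₂.mulVecLin, r z = z := by
    intro z
    apply Subtype.ext
    have : d₂.mulVecLin.rangeRestrict z = 0 := Subtype.ext z.2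
    change (z : I₁ → ℤ) - s (d₂.mulVecLin.rangeRestrict z) = z
    rw [this, map_zero, sub_zero]
  let f : (I₁ → ℤ) →ₗ[ℤ] ℤ := g.toIntLinearMap.comp r
  have hf : ∀ u, f u = (fun j => f (Pi.single j 1)) ⬝ᵥ u := by
    intro u
    conv_lhs => rw [pi_eq_sum_univ' u]
    rw [map_sum, dotProduct]
    refine Finset.sum_congr rfl fun j _ => ?_
    rw [mul_comm, ← smul_eq_mul, ← map_smul]
  obtain ⟨m, u, hm, hmu⟩ := h.surj (fun j => f (Pi.single j 1)) (by
    ext j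
    have e1 : ((fun j => f (Pi.single j 1)) ᵥ* d₁) j = f (d₁ *ᵥ Pi.single j 1) := by
      rw [hf, Matrix.dotProduct_mulVec]
      simp
    have e2 : d₂ *ᵥ (d₁ *ᵥ Pi.single j 1) = 0 := by
      rw [Matrix.mulVec_mulVec, h.d_comp_d, Matrix.zero_mulVec]
    have e3 := hg ⟨d₁ *ᵥ Pi.single j 1, e2⟩
    obtain ⟨ψ, hψ⟩ := h.left
    have e4 : (d₁ *ᵥ Pi.single j 1) ⬝ᵥ φ *ᵥ (w : I₁ → ℤ) = 0 := by
      have hw : d₂ *ᵥ (w : I₁ → ℤ) = 0 := w.2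
      rw [← Matrix.vecMul_transpose, ← Matrix.dotProduct_mulVec, Matrix.mulVec_mulVec, hψ,
        ← Matrix.mulVec_mulVec, hw]
      simp
    rw [e1]
    have e5 : f (d₁ *ᵥ Pi.single j 1) = g ⟨d₁ *ᵥ Pi.single j 1, e2⟩ :=
      congrArg g (hr ⟨d₁ *ᵥ Pi.single j 1, e2⟩)
    rw [e5]
    rw [e4] at e3
    exact (mul_eq_zero.mp e3).resolve_left hN)
  refine ⟨⟨m, hm⟩, fun z => ?_⟩
  have hz : d₂ *ᵥ (z : I₁ → ℤ) = 0 := z.2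
  have e : g z = f z := congrArg g (hr z).symm
  rw [e, hf, hmu, add_dotProduct, ← Matrix.dotProduct_mulVec, ← Matrix.dotProduct_mulVec, hz,
    dotProduct_zero, add_zero]
  exact h.pairing_symm hm hz

/-- The Gauss sum modulo 4 is, up to a positive factor, the Gauss sum of the form on integral
cocycles, and its phase is the signature modulo 8. -/
theorem gaussSumModFour_phase (h : MiddleDuality d₁ d₂ φ) {J : Type*} [Fintype J]
    (v : J → LinearMap.ker d₂.mulVecLin) (a : J → ℤ) (ha : ∀ j, a j ≠ 0)
    (hortho : ∀ i j, i ≠ j → cocyclePairing d₂ φ (v i) (v j) = 0)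
    (hdiag : ∀ j, cocyclePairing d₂ φ (v j) (v j) = a j)
    (hQ : ∀ z w, (cocyclePairing d₂ φ z w : ℚ) =
      ∑ j, (cocyclePairing d₂ φ z (v j) : ℚ) * cocyclePairing d₂ φ w (v j) / a j) :
    PosProportional (gaussSumModFour (d₂.map (Int.cast : ℤ → ZMod 4)) (φ.map (Int.cast : ℤ → ZMod 4)))
      (zetaEight ^ (∑ j, (SignType.sign (a j) : ℤ))) := by
  set K := LinearMap.ker (d₂.map (Int.cast : ℤ → ZMod 4)).mulVecLin with hK
  let _ : Fintype K := Fintype.ofFinite K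
  let f : K → ℂ := fun x =>
    modFourChar ((x : I₁ → ZMod 4) ⬝ᵥ φ.map (Int.cast : ℤ → ZMod 4) *ᵥ x)
  -- reduction of integral cochains which are cocycles modulo 4
  let X : AddSubgroup (I₁ → ℤ) :=
    { carrier := {x | ∃ y, d₂ *ᵥ x = (4 : ℤ) • y}
      zero_mem' := ⟨0, by simp⟩
      add_mem' := fun {x x'} ⟨y, hy⟩ ⟨y', hy'⟩ => ⟨y + y', by rw [Matrix.mulVec_add, hy, hy', smul_add]⟩
      neg_mem' := fun {x} ⟨y, hy⟩ => ⟨-y, by rw [Matrix.mulVec_neg, hy, smul_neg]⟩ }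
  let c : X →+ K :=
    { toFun := fun x => ⟨fun j => ((x : I₁ → ℤ) j : ZMod 4), by
        obtain ⟨y, hy⟩ := x.2
        rw [LinearMap.mem_ker, Matrix.mulVecLin_apply, ← intCast_mulVec, hy]
        ext i
        have : (4 : ZMod 4) = 0 := rfl
        simp [this]⟩
      map_zero' := by ext; simp
      map_add' := fun x y => by ext; simp }
  have hc : Function.Surjective c := by
    intro x
    refine ⟨⟨fun j => ((x : I₁ → ZMod 4) j).val, ?_⟩, by ext j; simp [c]⟩
    have h1 : (d₂.map (Int.cast : ℤ → ZMod 4)) *ᵥ (x : I₁ → ZMod 4) = 0 := x.2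
    have h2 : ∀ i, ∃ t, (d₂ *ᵥ fun j => (((x : I₁ → ZMod 4) j).val : ℤ)) i = 4 * t := by
      intro i
      have h3 := congrFun (intCast_mulVec (ZMod 4) d₂ fun j => (((x : I₁ → ZMod 4) j).val : ℤ)) i
      have h4 : (fun j => ((((x : I₁ → ZMod 4) j).val : ℤ) : ZMod 4)) = x := by ext j; simp
      rw [h4, h1] at h3
      exact (ZMod.intCast_zmod_eq_zero_iff_dvd _ 4).mp h3
    choose t ht using h2
    exact ⟨t, funext fun i => by rw [ht]; rfl⟩
  have hfc : ∀ x : X, f (c x) = ratChar ((((x : I₁ → ℤ) ⬝ᵥ φ *ᵥ x : ℤ) : ℚ) / 4) := by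
    intro x
    rw [← modFourChar_intCast, intCast_pairing]
    rfl
  have hBX : torsionCocycles d₁ ≤ X := fun b hb => ⟨0, by rw [h.cocycle_of_torsionCocycles hb]; simp⟩
  have hZX : ∀ z, z ∈ LinearMap.ker d₂.mulVecLin → z ∈ X := fun z hz => ⟨0, by
    rw [smul_zero]; exact hz⟩
  obtain ⟨ψ, ψ', hcomm⟩ := h.pairing_comm
  have hshift : ∀ (x : X) (b : torsionCocycles d₁), f (c x + c ⟨b, hBX b.2⟩) =
      f (c x) * ratChar ((((x : I₁ → ℤ) ⬝ᵥ φ *ᵥ b : ℤ) : ℚ) / 2) := by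
    intro x b
    have hb := h.cocycle_of_torsionCocycles b.2
    obtain ⟨y, hy⟩ := x.2
    rw [← map_add, hfc, hfc, ← ratChar_add]
    have e : ((((x : I₁ → ℤ) ⬝ᵥ φ *ᵥ x : ℤ) : ℚ) / 4) +
        ((((x : I₁ → ℤ) ⬝ᵥ φ *ᵥ b : ℤ) : ℚ) / 2) =
        ((((x : I₁ → ℤ) ⬝ᵥ φ *ᵥ x + 2 * ((x : I₁ → ℤ) ⬝ᵥ φ *ᵥ b) : ℤ) : ℚ) / 4) := by
      push_cast; ring
    rw [e]
    apply ratChar_div_four_eq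
    -- As `d₂ x = 4y`, the two cross terms `x φ b` and `b φ x` differ by four times this integer,
    -- while `b φ b = 0`.
    refine ⟨(b : I₁ → ℤ) ⬝ᵥ ψ *ᵥ y, ?_⟩
    have e1 := hcomm b x
    have e2 := h.pairing_torsionCocycles hb b.2
    rw [hb, hy, Matrix.mulVec_smul, dotProduct_smul, zero_dotProduct, smul_eq_mul] at e1
    simp only [AddSubgroup.coe_add, Matrix.mulVec_add, dotProduct_add, add_dotProduct]
    linear_combination e1 + e2
  let Bc : torsionCocycles d₁ →+ K := c.comp (AddSubgroup.inclusion hBX)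
  let W : AddSubgroup (I₁ → ℤ) :=
    { carrier := {x | ∃ y, d₂ *ᵥ x = (2 : ℤ) • y}
      zero_mem' := ⟨0, by simp⟩
      add_mem' := fun {x x'} ⟨y, hy⟩ ⟨y', hy'⟩ => ⟨y + y', by rw [Matrix.mulVec_add, hy, hy', smul_add]⟩
      neg_mem' := fun {x} ⟨y, hy⟩ => ⟨-y, by rw [Matrix.mulVec_neg, hy, smul_neg]⟩ }
  let s : (LinearMap.ker d₂.mulVecLin × W) →+ X :=
    { toFun := fun p => ⟨(p.1 : I₁ → ℤ) + (2 : ℤ) • (p.2 : I₁ → ℤ), by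
        have h1 : d₂ *ᵥ (p.1 : I₁ → ℤ) = 0 := p.1.2
        obtain ⟨y, hy⟩ := p.2.2
        refine ⟨y, ?_⟩
        rw [Matrix.mulVec_add, h1, Matrix.mulVec_smul, hy, zero_add, smul_smul]
        norm_num⟩
      map_zero' := by ext; simp
      map_add' := fun p p' => by ext; simp; ring }
  let pz : LinearMap.ker d₂.mulVecLin →+ K :=
    { toFun := fun z => c ⟨z, hZX z z.2⟩
      map_zero' := map_zero c
      map_add' := fun z z' => (map_add c ⟨z, hZX z z.2⟩ ⟨z', hZX z' z'.2⟩) }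
  have hf0 : ∀ x, f x ≠ 0 := fun x => ratChar_ne_zero _
  let _ : Fintype pz.range := Fintype.ofFinite _
  have step1 : PosProportional (∑ x, f x) (∑ g : pz.range, f g) := by
    refine sum_posProportional_of_isotropic Bc.range f hf0 ?_ (c.comp s) ?_
      (pz.rangeRestrict.comp (AddMonoidHom.fst _ _))
      (pz.rangeRestrict_surjective.comp Prod.fst_surjective) (fun g => f g) ?_
    · rintro x _ ⟨b, rfl⟩ _ ⟨b', rfl⟩
      obtain ⟨x, rfl⟩ := hc x
      have e : ∀ b, Bc b = c ⟨b, hBX b.2⟩ := fun b => rfl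
      rw [← map_add, e, e, e, hshift, hshift, hshift, AddSubgroup.coe_add, Matrix.mulVec_add,
        dotProduct_add, Int.cast_add, add_div, ratChar_add]
      ring
    · intro x
      obtain ⟨x, rfl⟩ := hc x
      have e : ∀ b, Bc b = c ⟨b, hBX b.2⟩ := fun b => rfl
      constructor
      · intro hx
        have hx' : ∀ b ∈ torsionCocycles d₁, Even ((x : I₁ → ℤ) ⬝ᵥ φ *ᵥ b) := by
          intro b hb
          have h1 := hx (Bc ⟨b, hb⟩) ⟨_, rfl⟩
          rw [e, hshift, mul_eq_left₀ (hf0 _), ratChar_eq_one_iff] at h1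
          obtain ⟨n, hn⟩ := h1
          refine ⟨n, ?_⟩
          have : ((((x : I₁ → ℤ) ⬝ᵥ φ *ᵥ b : ℤ) : ℚ)) = ((n + n : ℤ) : ℚ) := by
            push_cast; linarith
          exact_mod_cast this
        obtain ⟨y, hy⟩ := x.2
        -- Since `d₂ x = 4y = 2(2y)`, the resulting `w` satisfies `d₂ w = 2y`: it is a cocycle
        -- modulo 2, and `x - 2w` is an integral cocycle.
        obtain ⟨w, hw⟩ := h.exists_coboundary_eq (y := (2 : ℤ) • y)
          (by rw [hy, smul_smul]; norm_num) hx'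
        refine ⟨(⟨(x : I₁ → ℤ) - (2 : ℤ) • w, ?_⟩, ⟨w, y, hw⟩), ?_⟩
        · rw [LinearMap.mem_ker, Matrix.mulVecLin_apply, Matrix.mulVec_sub, Matrix.mulVec_smul, hw,
            hy, smul_smul]
          norm_num
        · refine congrArg c (Subtype.ext ?_)
          exact sub_add_cancel _ _
      · rintro ⟨⟨z, w⟩, hzw⟩ _ ⟨b, rfl⟩
        rw [← hzw]
        have hz : d₂ *ᵥ (z : I₁ → ℤ) = 0 := z.2
        have e' : (c.comp s) (z, w) = c (s (z, w)) := rfl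
        rw [e, e', hshift, (ratChar_eq_one_iff _).mpr, mul_one]
        refine ⟨(w : I₁ → ℤ) ⬝ᵥ φ *ᵥ b, ?_⟩
        have e1 := h.pairing_torsionCocycles hz b.2
        have e2 : ((s (z, w) : X) : I₁ → ℤ) = (z : I₁ → ℤ) + (2 : ℤ) • (w : I₁ → ℤ) := rfl
        rw [e2, add_dotProduct, smul_dotProduct, e1]
        simp
    · rintro ⟨z, w⟩
      have hz : d₂ *ᵥ (z : I₁ → ℤ) = 0 := z.2
      obtain ⟨y, hy⟩ := w.2
      have e' : (c.comp s) (z, w) = c (s (z, w)) := rfl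
      have e'' : ((pz.rangeRestrict.comp (AddMonoidHom.fst _ _)) (z, w) : K) =
        c ⟨z, hZX z z.2⟩ := rfl
      rw [e', e'', hfc, hfc]
      apply ratChar_div_four_eq
      have e2 : ((s (z, w) : X) : I₁ → ℤ) = (z : I₁ → ℤ) + (2 : ℤ) • (w : I₁ → ℤ) := rfl
      -- `z φ w` and `w φ z` agree modulo 2, so twice their sum vanishes modulo 4.
      have e1 := hcomm w z
      rw [hz, hy, Matrix.mulVec_zero, dotProduct_zero, smul_dotProduct, smul_eq_mul] at e1
      refine ⟨(z : I₁ → ℤ) ⬝ᵥ φ *ᵥ w + y ⬝ᵥ ψ' *ᵥ (z : I₁ → ℤ) + (w : I₁ → ℤ) ⬝ᵥ φ *ᵥ w, ?_⟩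
      rw [e2]
      simp only [Matrix.mulVec_add, dotProduct_add, add_dotProduct, Matrix.mulVec_smul,
        dotProduct_smul, smul_dotProduct, smul_eq_mul]
      linear_combination 2 * e1
  refine step1.trans ?_
  refine gaussSum_phase_of_nonsingular (cocyclePairing d₂ φ) v a ha hortho hdiag hQ
    (fun g N w hN hg => h.exists_represents g N w hN hg) pz.rangeRestrict
    pz.rangeRestrict_surjective (fun g => f g) fun z => ?_
  exact hfc ⟨z, hZX z z.2⟩

end MiddleDuality

/-! ### Signatures and rational diagonalisations -/

/-- A positive definite subspace for `q` meets the kernel of `p` trivially, so its image is positive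
definite of the same dimension. This inequality needs no surjectivity; the reverse one applies it to
a section. -/
lemma sigPos_le_of_surjective {M M' : Type*} [AddCommGroup M] [AddCommGroup M'] [Module ℝ M]
    [Module ℝ M'] [FiniteDimensional ℝ M] [FiniteDimensional ℝ M'] (q : QuadraticForm ℝ M)
    (q' : QuadraticForm ℝ M') (p : M →ₗ[ℝ] M') (hq : ∀ x, q x = q' (p x)) :
    sigPos q ≤ sigPos q' := by
  obtain ⟨V, hV, hpos⟩ := exists_finrank_eq_sigPos_and_posDef q
  rw [← hV]
  have hinj : ∀ x ∈ V, p x = 0 → x = 0 := by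
    intro x hx h0
    by_contra hne
    have := hpos ⟨x, hx⟩ (by simpa using hne)
    rw [QuadraticMap.restrict_apply, hq, h0, map_zero] at this
    exact lt_irrefl _ this
  have e : Module.finrank ℝ (V.map p) = Module.finrank ℝ V := by
    have h1 : V.map p = LinearMap.range (p.comp V.subtype) := by
      rw [LinearMap.range_comp, Submodule.range_subtype]
    rw [h1]
    apply LinearMap.finrank_range_of_inj
    rw [← LinearMap.ker_eq_bot, LinearMap.ker_eq_bot']
    exact fun x hx => Subtype.ext (hinj x x.2 hx)
  rw [← e]
  apply le_sigPos_of_posDef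
  rintro ⟨_, x, hx, rfl⟩ hne
  rw [QuadraticMap.restrict_apply, ← hq]
  refine hpos ⟨x, hx⟩ fun h => hne ?_
  have h0 : x = 0 := congrArg Subtype.val h
  exact Subtype.ext (by simp [h0])

lemma sigPos_eq_of_surjective {M M' : Type*} [AddCommGroup M] [AddCommGroup M'] [Module ℝ M]
    [Module ℝ M'] [FiniteDimensional ℝ M] [FiniteDimensional ℝ M'] (q : QuadraticForm ℝ M)
    (q' : QuadraticForm ℝ M') (p : M →ₗ[ℝ] M') (hp : Function.Surjective p)
    (hq : ∀ x, q x = q' (p x)) : sigPos q = sigPos q' := by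
  refine le_antisymm (sigPos_le_of_surjective q q' p hq) ?_
  obtain ⟨s, hs⟩ := LinearMap.exists_rightInverse_of_surjective p (LinearMap.range_eq_top.mpr hp)
  refine sigPos_le_of_surjective q' q s fun x => ?_
  rw [hq]
  exact congrArg q' (LinearMap.congr_fun hs x).symm

lemma sum_sign_eq {J : Type*} [Fintype J] (w : J → ℝ) :
    ∑ j, (SignType.sign (w j) : ℤ) = ({i | 0 < w i}.ncard : ℤ) - ({i | w i < 0}.ncard : ℤ) := by
  classical
  rw [Set.ncard_eq_toFinset_card', Set.ncard_eq_toFinset_card', Set.toFinset_ofPred,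
    Set.toFinset_ofPred, Finset.card_filter, Finset.card_filter]
  push_cast
  rw [← Finset.sum_sub_distrib]
  refine Finset.sum_congr rfl fun j _ => ?_
  rcases lt_trichotomy (w j) 0 with h | h | h
  · simp [h, h.le.not_gt]
  · simp [h]
  · simp [h, h.le.not_gt]

/-- The signature of a real form which is diagonal, with weights `w`, on a quotient. -/
lemma sigPos_sub_sigNeg_eq_sum_sign {M J : Type*} [AddCommGroup M] [Module ℝ M]
    [FiniteDimensional ℝ M] [Fintype J] (q : QuadraticForm ℝ M) (p : M →ₗ[ℝ] (J → ℝ))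
    (hp : Function.Surjective p) (w : J → ℝ) (hq : ∀ x, q x = ∑ j, w j * (p x j * p x j)) :
    (sigPos q : ℤ) - (sigNeg q : ℤ) = ∑ j, (SignType.sign (w j) : ℤ) := by
  have h1 : ∀ x, q x = QuadraticMap.weightedSumSquares ℝ w (p x) := by
    intro x
    rw [hq, QuadraticMap.weightedSumSquares_apply]
    rfl
  rw [sigPos_eq_of_surjective q _ p hp h1,
    show sigNeg q = sigNeg (QuadraticMap.weightedSumSquares ℝ w) from
      sigPos_eq_of_surjective (-q) (-(QuadraticMap.weightedSumSquares ℝ w)) p hp fun x => by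
        rw [neg_apply, neg_apply, h1],
    QuadraticForm.sigPos_weightedSumSquares, QuadraticForm.sigNeg_weightedSumSquares, sum_sign_eq]

/-! ### Integral cocycles inside the rational and real cocycles. -/

lemma intCast_mem_ker {I₁ I₂ : Type*} [Fintype I₁] (R : Type*) [CommRing R] {d : Matrix I₂ I₁ ℤ}
    (z : LinearMap.ker d.mulVecLin) :
    (fun j => ((z : I₁ → ℤ) j : R)) ∈ LinearMap.ker (d.map (Int.cast : ℤ → R)).mulVecLin := by
  have hz : d *ᵥ (z : I₁ → ℤ) = 0 := z.2
  rw [LinearMap.mem_ker, Matrix.mulVecLin_apply, ← intCast_mulVec, hz]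
  ext
  simp

/-- The rational kernel of an integral matrix consists of rational multiples of integral vectors. -/
lemma exists_smul_eq_intCast {I₁ I₂ : Type*} [Fintype I₁] (d : Matrix I₂ I₁ ℤ) (x : I₁ → ℚ)
    (hx : (d.map (Int.cast : ℤ → ℚ)) *ᵥ x = 0) :
    ∃ N : ℚ, N ≠ 0 ∧ ∃ z : LinearMap.ker d.mulVecLin, N • x = fun j => ((z : I₁ → ℤ) j : ℚ) := by
  obtain ⟨b, hb⟩ := IsLocalization.exist_integer_multiples (nonZeroDivisors ℤ) Finset.univ x
  choose z hz using fun i => hb i (Finset.mem_univ i)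
  have hbne : ((b : ℤ) : ℚ) ≠ 0 := by exact_mod_cast nonZeroDivisors.ne_zero b.2
  have e : ((b : ℤ) : ℚ) • x = fun j => (z j : ℚ) := by
    ext i
    have := hz i
    simp only [algebraMap_int_eq, eq_intCast] at this
    rw [this]
    simp
  refine ⟨b, hbne, ⟨z, ?_⟩, e⟩
  have h1 := intCast_mulVec ℚ d z
  rw [← e, Matrix.mulVec_smul, hx, smul_zero] at h1
  rw [LinearMap.mem_ker, Matrix.mulVecLin_apply]
  ext i
  have := congrFun h1 i
  simpa using this

/-- The real kernel of an integral matrix is spanned by the integral kernel. -/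
lemma mem_span_intCast {I₁ I₂ : Type*} [Fintype I₁] (d : Matrix I₂ I₁ ℤ) (x : I₁ → ℝ)
    (hx : (d.map (Int.cast : ℤ → ℝ)) *ᵥ x = 0) :
    x ∈ Submodule.span ℝ (Set.range fun (z : LinearMap.ker d.mulVecLin) (j : I₁) =>
      ((z : I₁ → ℤ) j : ℝ)) := by
  classical
  -- Expanding the real coordinates in a ℚ-basis of ℝ splits the integral equations into rational
  -- systems, one for each basis element.
  let β := Module.Basis.ofVectorSpace ℚ ℝ
  let y : _ → I₁ → ℚ := fun h i => β.repr (x i) h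
  have hy : ∀ h, (d.map (Int.cast : ℤ → ℚ)) *ᵥ y h = 0 := by
    intro h
    ext i
    have h1 := congrArg (fun t => β.repr t h) (congrFun hx i)
    have h2 : ((d.map (Int.cast : ℤ → ℝ)) *ᵥ x) i = ∑ j, ((d i j : ℤ) : ℚ) • x j := by
      simp [Matrix.mulVec, dotProduct, Rat.smul_def]
    simp only [h2, map_sum, map_smul] at h1
    simpa [Matrix.mulVec, dotProduct, Finsupp.finsetSum_apply] using h1
  let S := Finset.univ.biUnion fun i => (β.repr (x i)).support
  have e : x = ∑ h ∈ S, β h • fun j => ((y h j : ℚ) : ℝ) := by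
    ext i
    rw [Finset.sum_apply]
    conv_lhs => rw [← β.linearCombination_repr (x i), Finsupp.linearCombination_apply,
      Finsupp.sum_of_support_subset (s := S) _ (Finset.subset_biUnion_of_mem
        (fun i => (β.repr (x i)).support) (Finset.mem_univ i)) _ (by simp)]
    refine Finset.sum_congr rfl fun h _ => ?_
    rw [Rat.smul_def, Pi.smul_apply, smul_eq_mul, mul_comm]
  rw [e]
  refine Submodule.sum_mem _ fun h _ => Submodule.smul_mem _ _ ?_
  obtain ⟨N, hN, z, hz⟩ := exists_smul_eq_intCast d (y h) (hy h)
  have e2 : (fun j => ((y h j : ℚ) : ℝ)) = ((N : ℝ)⁻¹) • fun j => ((z : I₁ → ℤ) j : ℝ) := by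
    ext j
    have h1 := congrFun hz j
    rw [Pi.smul_apply, smul_eq_mul] at h1 ⊢
    have h2 : ((N : ℚ) : ℝ) * (y h j : ℚ) = ((z : I₁ → ℤ) j : ℝ) := by exact_mod_cast h1
    have h3 : ((N : ℚ) : ℝ) ≠ 0 := by exact_mod_cast hN
    rw [← h2]
    field_simp
  rw [e2]
  exact Submodule.smul_mem _ _ (Submodule.subset_span ⟨z, rfl⟩)

/-- A form which is symmetric on integral cocycles is diagonalised over `ℚ`, modulo its radical, by
integral cocycles. -/
lemma exists_rational_diagonalisation {I₁ I₂ : Type*} [Fintype I₁] (d : Matrix I₂ I₁ ℤ)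
    (φ : Matrix I₁ I₁ ℤ) (hsymm : ∀ z w, cocyclePairing d φ z w = cocyclePairing d φ w z) :
    ∃ (J : Type) (_ : Fintype J) (v : J → LinearMap.ker d.mulVecLin) (a : J → ℤ), (∀ j, a j ≠ 0) ∧
      (∀ i j, i ≠ j → cocyclePairing d φ (v i) (v j) = 0) ∧
      (∀ j, cocyclePairing d φ (v j) (v j) = a j) ∧
      ∀ z w, (cocyclePairing d φ z w : ℚ) =
        ∑ j, (cocyclePairing d φ z (v j) : ℚ) * cocyclePairing d φ w (v j) / a j := by
  classical
  let V := LinearMap.ker (d.map (Int.cast : ℤ → ℚ)).mulVecLin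
  let B : LinearMap.BilinForm ℚ V :=
    (Matrix.toBilin' (φ.map (Int.cast : ℤ → ℚ))).restrict V
  let ι : LinearMap.ker d.mulVecLin → V := fun z => ⟨_, intCast_mem_ker ℚ z⟩
  have hB : ∀ z w, B (ι z) (ι w) = (cocyclePairing d φ z w : ℚ) := by
    intro z w
    rw [cocyclePairing_apply, intCast_pairing]
    exact Matrix.toBilin'_apply' _ _ _
  have hscale : ∀ x : V, ∃ N : ℚ, N ≠ 0 ∧ ∃ z, N • x = ι z := by
    intro x
    obtain ⟨N, hN, z, hz⟩ := exists_smul_eq_intCast d x x.2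
    exact ⟨N, hN, z, Subtype.ext hz⟩
  have hBsymm : LinearMap.IsSymm B := by
    constructor
    intro x y
    obtain ⟨N, hN, z, hz⟩ := hscale x
    obtain ⟨N', hN', w, hw⟩ := hscale y
    have h1 := hB z w
    have h2 := hB w z
    rw [hsymm z w, ← h2, ← hz, ← hw] at h1
    simp only [map_smul, LinearMap.smul_apply, smul_eq_mul] at h1
    rw [mul_left_comm N' N] at h1
    exact mul_left_cancel₀ hN' (mul_left_cancel₀ hN h1)
  let : Invertible (2 : ℚ) := invertibleOfNonzero two_ne_zero
  obtain ⟨u, hu⟩ := LinearMap.BilinForm.exists_orthogonal_basis hBsymm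
  choose N hN z hz using fun i => hscale (u i)
  let u' := u.unitsSMul fun i => Units.mk0 (N i) (hN i)
  have hu' : ∀ i, u' i = ι (z i) := by
    intro i
    rw [← hz]
    exact u.unitsSMul_apply i
  have hortho : ∀ i j, i ≠ j → cocyclePairing d φ (z i) (z j) = 0 := by
    intro i j hij
    have h1 : B (u i) (u j) = 0 := hu hij
    have h2 := hB (z i) (z j)
    rw [← hz, ← hz] at h2
    simp only [map_smul, LinearMap.smul_apply, smul_eq_mul, h1, mul_zero] at h2
    exact_mod_cast h2.symm
  -- Orthogonal basis vectors of square zero lie in the radical and are dropped.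
  refine ⟨{i // cocyclePairing d φ (z i) (z i) ≠ 0}, inferInstance, fun j => z j,
    fun j => cocyclePairing d φ (z j) (z j), fun j => j.2,
    fun i j hij => hortho i j fun h => hij (Subtype.ext h), fun j => rfl, fun x y => ?_⟩
  have hcoef : ∀ x i, (cocyclePairing d φ x (z i) : ℚ) =
      u'.repr (ι x) i * cocyclePairing d φ (z i) (z i) := by
    intro x i
    rw [← hB, ← hB, ← hu']
    conv_lhs => rw [← u'.sum_repr (ι x)]
    rw [map_sum, LinearMap.sum_apply, Finset.sum_eq_single i]
    · rw [map_smul, LinearMap.smul_apply, smul_eq_mul]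
    · intro j _ hj
      rw [map_smul, LinearMap.smul_apply, hu', hu', hB, hortho j i hj]
      simp
    · simp
  have h1 : (cocyclePairing d φ x y : ℚ) =
      ∑ i, u'.repr (ι y) i * (cocyclePairing d φ x (z i) : ℚ) := by
    rw [← hB]
    conv_lhs => rw [← u'.sum_repr (ι y)]
    rw [map_sum]
    refine Finset.sum_congr rfl fun i _ => ?_
    rw [map_smul, hu', hB, smul_eq_mul]
  rw [h1, ← Finset.sum_filter_of_ne (p := fun i => cocyclePairing d φ (z i) (z i) ≠ 0),
    Finset.sum_subtype (p := fun i => cocyclePairing d φ (z i) (z i) ≠ 0) _ (by simp)]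
  · refine Finset.sum_congr rfl fun j _ => ?_
    have hj : (cocyclePairing d φ (z j) (z j) : ℚ) ≠ 0 := by exact_mod_cast j.2
    rw [hcoef y j]
    field_simp
  · intro i _ h0 h2
    rw [hcoef x i, h2] at h0
    simp at h0

namespace SymmetricComplex

/-- The signature in terms of a rational diagonalisation of the form on integral cocycles. -/
theorem signature_eq_sum_sign {k : ℤ} (C : SymmetricComplex ℤ (4 * k)) {J : Type*} [Fintype J]
    (v : J → LinearMap.ker (C.d (2 * k + 1) (2 * k)).mulVecLin) (a : J → ℤ) (ha : ∀ j, a j ≠ 0)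
    (hortho : ∀ i j, i ≠ j → cocyclePairing _ (C.φ 0 (2 * k) (2 * k)) (v i) (v j) = 0)
    (hdiag : ∀ j, cocyclePairing _ (C.φ 0 (2 * k) (2 * k)) (v j) (v j) = a j)
    (hQ : ∀ z w, (cocyclePairing _ (C.φ 0 (2 * k) (2 * k)) z w : ℚ) =
      ∑ j, (cocyclePairing _ (C.φ 0 (2 * k) (2 * k)) z (v j) : ℚ) *
        cocyclePairing _ (C.φ 0 (2 * k) (2 * k)) w (v j) / a j) :
    C.signature = ∑ j, (SignType.sign (a j) : ℤ) := by
  classical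
  let Q := cocyclePairing (C.d (2 * k + 1) (2 * k)) (C.φ 0 (2 * k) (2 * k))
  let ι : LinearMap.ker (C.d (2 * k + 1) (2 * k)).mulVecLin → C.cocycles (2 * k) :=
    fun z => ⟨_, intCast_mem_ker ℝ z⟩
  let b : LinearMap.BilinForm ℝ (C.cocycles (2 * k)) :=
    (C.cochainForm (2 * k)).restrict (C.cocycles (2 * k))
  have hb : ∀ z w, b (ι z) (ι w) = (Q z w : ℝ) := by
    intro z w
    rw [cocyclePairing_apply, intCast_pairing]
    exact C.cochainForm_apply _ _ _
  have hspan : ∀ x : C.cocycles (2 * k), x ∈ Submodule.span ℝ (Set.range ι) := by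
    intro x
    have h1 := mem_span_intCast _ (x : C.ι (2 * k) → ℝ) x.2
    have h2 : (Set.range fun (z : LinearMap.ker (C.d (2 * k + 1) (2 * k)).mulVecLin)
        (j : C.ι (2 * k)) => ((z : C.ι (2 * k) → ℤ) j : ℝ)) =
        (C.cocycles (2 * k)).subtype '' Set.range ι := by
      rw [← Set.range_comp]
      rfl
    rw [h2, Submodule.span_image] at h1
    obtain ⟨y, hy, hyx⟩ := h1
    rwa [← Subtype.ext hyx]
  have haR : ∀ j, (a j : ℝ) ≠ 0 := fun j => by exact_mod_cast ha j
  have hform : ∀ x y, b x y = ∑ j, (a j : ℝ)⁻¹ * (b x (ι (v j)) * b y (ι (v j))) := by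
    intro x y
    induction hspan x using Submodule.span_induction with
    | mem x hx =>
      obtain ⟨z, rfl⟩ := hx
      induction hspan y using Submodule.span_induction with
      | mem y hy =>
        obtain ⟨w, rfl⟩ := hy
        simp only [hb]
        have h1 := congrArg (Rat.cast : ℚ → ℝ) (hQ z w)
        push_cast at h1
        rw [h1]
        refine Finset.sum_congr rfl fun j _ => ?_
        rw [div_eq_inv_mul]
      | zero => simp
      | add y y' _ _ h h' =>
        rw [map_add, h, h', ← Finset.sum_add_distrib]
        refine Finset.sum_congr rfl fun j _ => ?_
        rw [map_add, LinearMap.add_apply]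
        ring
      | smul c y _ h =>
        rw [map_smul, h, smul_eq_mul, Finset.mul_sum]
        refine Finset.sum_congr rfl fun j _ => ?_
        rw [map_smul, LinearMap.smul_apply, smul_eq_mul]
        ring
    | zero => simp
    | add y y' _ _ h h' =>
      rw [map_add, LinearMap.add_apply, h, h', ← Finset.sum_add_distrib]
      refine Finset.sum_congr rfl fun j _ => ?_
      rw [LinearMap.add_apply]
      ring
    | smul c y _ h =>
      rw [map_smul, LinearMap.smul_apply, h, smul_eq_mul, Finset.mul_sum]
      refine Finset.sum_congr rfl fun j _ => ?_
      rw [LinearMap.smul_apply, smul_eq_mul]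
      ring
  let β := C.cohomologyForm (2 * k) (by ring)
  have hβ : ∀ x y : C.cocycles (2 * k), β ((C.coboundaries (2 * k)).mkQ x)
      ((C.coboundaries (2 * k)).mkQ y) = b x y := fun x y => rfl
  let p : C.cohomology (2 * k) →ₗ[ℝ] (J → ℝ) :=
    LinearMap.pi fun j => β.flip ((C.coboundaries (2 * k)).mkQ (ι (v j)))
  have hpv : ∀ i, p ((C.coboundaries (2 * k)).mkQ (ι (v i))) = Pi.single i (a i : ℝ) := by
    intro i
    ext j
    have h1 : p ((C.coboundaries (2 * k)).mkQ (ι (v i))) j = b (ι (v i)) (ι (v j)) := rfl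
    rw [h1, hb]
    rcases eq_or_ne j i with rfl | h
    · rw [hdiag]; simp
    · rw [hortho i j h.symm]; simp [h]
  have hp : Function.Surjective p := by
    intro y
    refine ⟨∑ j, (y j / a j) • (C.coboundaries (2 * k)).mkQ (ι (v j)), ?_⟩
    rw [map_sum]
    conv_rhs => rw [pi_eq_sum_univ' y]
    refine Finset.sum_congr rfl fun j _ => ?_
    rw [map_smul, hpv]
    ext i
    rcases eq_or_ne i j with rfl | h
    · simp [haR]
    · simp [h]
  -- In the coordinates given by pairing with `v j`, the weights are the inverses of the `a j`,
  -- which have the same signs.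
  rw [signature, sigPos_sub_sigNeg_eq_sum_sign _ p hp (fun j => (a j : ℝ)⁻¹)]
  · refine Finset.sum_congr rfl fun j _ => ?_
    congr 1
    rcases lt_or_gt_of_ne (ha j) with h | h
    · rw [sign_neg h, sign_neg (inv_lt_zero.mpr (by exact_mod_cast h))]
    · rw [sign_pos h, sign_pos (inv_pos.mpr (by exact_mod_cast h))]
  · intro x
    obtain ⟨x, rfl⟩ := (C.coboundaries (2 * k)).mkQ_surjective x
    exact hform x x

end SymmetricComplex

/-! ### Poincaré duality around the middle dimension -/

namespace SymmetricComplex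

/-- Poincaré duality with the dual complex written out. -/
lemma IsPoincare.exists_inverse {R : Type*} [Ring R] [StarRing R] {n : ℤ}
    {C : SymmetricComplex R n} (hC : C.IsPoincare) :
    ∃ g : ∀ r, Matrix (C.ι r) (C.ι (n - r)) R,
      (∀ i j, C.d i j * g j = g i * (i.negOnePow • (C.d (n - j) (n - i))ᴴ)) ∧
      (∃ h : ∀ i j, Matrix (C.ι (n - i)) (C.ι (n - j)) R, ∀ r, C.φ 0 (n - r) r * g r - 1 =
        (r.negOnePow • (C.d (n - (r - 1)) (n - r))ᴴ) * h (r - 1) r +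
        h r (r + 1) * ((r + 1).negOnePow • (C.d (n - r) (n - (r + 1)))ᴴ)) ∧
      ∃ h : ∀ i j, Matrix (C.ι i) (C.ι j) R, ∀ r, g r * C.φ 0 (n - r) r - 1 =
        C.d r (r - 1) * h (r - 1) r + h r (r + 1) * C.d (r + 1) r :=
  hC.2

/-- Poincaré duality at the level of matrices: `φ₀` is onto in homology. -/
lemma IsPoincare.exists_leftInverse {R : Type*} [Ring R] [StarRing R] {n : ℤ}
    {C : SymmetricComplex R n} (hC : C.IsPoincare) (p p' q q' q'' : ℤ) (hpq : p + q = n)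
    (hp' : p' = p + 1) (hq' : q' = q - 1) (hq'' : q'' = q + 1) :
    ∃ (G : Matrix (C.ι q) (C.ι p) R) (G' : Matrix (C.ι q') (C.ι p') R)
      (H : Matrix (C.ι q') (C.ι q) R) (H' : Matrix (C.ι q) (C.ι q'') R),
      G * C.φ 0 p q - 1 = C.d q q' * H + H' * C.d q'' q ∧
      G * (C.d p' p)ᴴ = C.d q q' * G' := by
  obtain ⟨g, hg, -, h, hh⟩ := hC.exists_inverse
  obtain rfl : p = n - q := by omega
  obtain rfl : p' = n - q' := by omega
  subst hq' hq''
  refine ⟨g q, q.negOnePow • g (q - 1), h (q - 1) q, h q (q + 1), hh q, ?_⟩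
  rw [Matrix.mul_smul, hg, Matrix.mul_smul, smul_smul, Int.units_mul_self, one_smul]

/-- Poincaré duality at the level of matrices: `φ₀` is injective in homology. -/
lemma IsPoincare.exists_rightInverse {R : Type*} [Ring R] [StarRing R] {n : ℤ}
    {C : SymmetricComplex R n} (hC : C.IsPoincare) (p p' p'' q q' : ℤ) (hpq : p' + q' = n)
    (hp' : p' = p + 1) (hp'' : p'' = p' + 1) (hq' : q = q' + 1) :
    ∃ (G : Matrix (C.ι q') (C.ι p') R) (G' : Matrix (C.ι q) (C.ι p) R)
      (H : Matrix (C.ι p'') (C.ι p') R) (H' : Matrix (C.ι p') (C.ι p) R),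
      C.φ 0 p' q' * G - 1 = (C.d p'' p')ᴴ * H + H' * (C.d p' p)ᴴ ∧
      C.d q q' * G = G' * (C.d p' p)ᴴ := by
  obtain ⟨g, hg, ⟨h, hh⟩, -⟩ := hC.exists_inverse
  obtain rfl : p' = n - q' := by omega
  obtain rfl : p'' = n - (q' - 1) := by omega
  subst hq'
  obtain rfl : p = n - (q' + 1) := by omega
  refine ⟨g q', (q' + 1).negOnePow • g (q' + 1), q'.negOnePow • h (q' - 1) q',
    (q' + 1).negOnePow • h q' (q' + 1), ?_, ?_⟩
  · rw [hh, Matrix.smul_mul, Matrix.mul_smul, Matrix.mul_smul, Matrix.smul_mul]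
  · rw [hg, Matrix.mul_smul, Matrix.smul_mul]

end SymmetricComplex

/-! ### Transfer of Poincaré duality to ℤ, and reduction modulo 4. -/

namespace SymmetricRepresentation

open scoped Kronecker

variable {π A : Type*} [Group π] [AddCommGroup A] {m : ℕ} {κ : Type} [Fintype κ] [DecidableEq κ]
  (ρ : SymmetricRepresentation π A m) (b : Module.Basis κ ℤ A)

lemma transfer_add {I J : Type} (f g : Matrix I J (MonoidAlgebra ℤ π)) :
    ρ.transfer b (f + g) = ρ.transfer b f + ρ.transfer b g := by
  ext ⟨i, a⟩ ⟨j, c⟩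
  simp [transfer]

lemma transfer_one {I : Type} [DecidableEq I] :
    ρ.transfer b (1 : Matrix I I (MonoidAlgebra ℤ π)) = 1 := by
  ext ⟨i, a⟩ ⟨j, c⟩
  by_cases h : i = j <;> simp [transfer, Matrix.one_apply, h]

lemma transferForm_eq {I J : Type} [Fintype I] [DecidableEq I]
    (f : Matrix I J (MonoidAlgebra ℤ π)) :
    ρ.transferForm b f = ((1 : Matrix I I ℤ) ⊗ₖ (ρ.gram b)⁻¹) * ρ.transfer b f := by
  have h : ((1 : Matrix I I ℤ) ⊗ₖ (ρ.gram b)⁻¹) = ρ.transferForm b 1 := by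
    ext ⟨i, a⟩ ⟨j, c⟩
    by_cases h : i = j <;> simp [transferForm, h]
  rw [h, transferForm_mul_transfer, Matrix.one_mul]

lemma kronecker_gram_mul_inv (I : Type) [Fintype I] [DecidableEq I] :
    ((1 : Matrix I I ℤ) ⊗ₖ ρ.gram b) * ((1 : Matrix I I ℤ) ⊗ₖ (ρ.gram b)⁻¹) = 1 := by
  rw [← Matrix.mul_kronecker_mul, Matrix.mul_nonsing_inv _ (ρ.isUnit_gram_det b), Matrix.one_mul,
    Matrix.one_kronecker_one]

lemma kronecker_inv_mul_gram (I : Type) [Fintype I] [DecidableEq I] :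
    ((1 : Matrix I I ℤ) ⊗ₖ (ρ.gram b)⁻¹) * ((1 : Matrix I I ℤ) ⊗ₖ ρ.gram b) = 1 := by
  rw [← Matrix.mul_kronecker_mul, Matrix.nonsing_inv_mul _ (ρ.isUnit_gram_det b), Matrix.one_mul,
    Matrix.one_kronecker_one]

lemma transfer_transpose_mul_inv {I J : Type} [Fintype I] [DecidableEq I] [Fintype J]
    [DecidableEq J] (f : Matrix J I (MonoidAlgebra ℤ π)) :
    (ρ.transfer b f)ᵀ * ((1 : Matrix J J ℤ) ⊗ₖ (ρ.gram b)⁻¹) =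
      ((1 : Matrix I I ℤ) ⊗ₖ (ρ.gram b)⁻¹) * ρ.transfer b fᴴ := by
  have h := ρ.transfer_transpose_mul b f (1 : Matrix J J (MonoidAlgebra ℤ π))
  rwa [transferForm_eq, transfer_one, Matrix.mul_one, Matrix.mul_one, transferForm_eq] at h

lemma gram_mul_transfer_transpose {I J : Type} [Fintype I] [DecidableEq I] [Fintype J]
    [DecidableEq J] (f : Matrix J I (MonoidAlgebra ℤ π)) :
    ((1 : Matrix I I ℤ) ⊗ₖ ρ.gram b) * (ρ.transfer b f)ᵀ =
      ρ.transfer b fᴴ * ((1 : Matrix J J ℤ) ⊗ₖ ρ.gram b) := by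
  calc _ = ((1 : Matrix I I ℤ) ⊗ₖ ρ.gram b) * ((ρ.transfer b f)ᵀ *
        (((1 : Matrix J J ℤ) ⊗ₖ (ρ.gram b)⁻¹) * ((1 : Matrix J J ℤ) ⊗ₖ ρ.gram b))) := by
        rw [kronecker_inv_mul_gram, Matrix.mul_one]
    _ = (((1 : Matrix I I ℤ) ⊗ₖ ρ.gram b) * ((1 : Matrix I I ℤ) ⊗ₖ (ρ.gram b)⁻¹)) *
        (ρ.transfer b fᴴ * ((1 : Matrix J J ℤ) ⊗ₖ ρ.gram b)) := by
        rw [← Matrix.mul_assoc (ρ.transfer b f)ᵀ, transfer_transpose_mul_inv]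
        simp only [Matrix.mul_assoc]
    _ = _ := by rw [kronecker_gram_mul_inv, Matrix.one_mul]

/-- The transferred homotopy inverse, followed by the Gram matrix, carries the cycle `c` to the
cocycle `z`. The transferred homotopy supplies the boundary correction `u`. -/
lemma transfer_surjective {P P' Q Q' Q'' : Type} [Fintype P] [DecidableEq P] [Fintype P']
    [DecidableEq P'] [Fintype Q] [DecidableEq Q] [Fintype Q'] [Fintype Q'']
    {φ : Matrix P Q (MonoidAlgebra ℤ π)} {d : Matrix Q Q' (MonoidAlgebra ℤ π)}
    {d' : Matrix Q'' Q (MonoidAlgebra ℤ π)} {e : Matrix P' P (MonoidAlgebra ℤ π)}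
    {G : Matrix Q P (MonoidAlgebra ℤ π)} {G' : Matrix Q' P' (MonoidAlgebra ℤ π)}
    {H : Matrix Q' Q (MonoidAlgebra ℤ π)} {H' : Matrix Q Q'' (MonoidAlgebra ℤ π)}
    (h1 : G * φ - 1 = d * H + H' * d') (h2 : G * eᴴ = d * G') (ε : ℤˣ) (c : Q × κ → ℤ)
    (hc : c ᵥ* ρ.transfer b d = 0) :
    ∃ z u, ρ.transfer b e *ᵥ z = 0 ∧
      c = z ᵥ* (ε • ρ.transferForm b φ) + u ᵥ* ρ.transfer b d' := by
  have h1' : ρ.transfer b (G * φ) =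
      1 + ρ.transfer b d * ρ.transfer b H + ρ.transfer b H' * ρ.transfer b d' := by
    rw [sub_eq_iff_eq_add.mp h1, transfer_add, transfer_add, transfer_one, ← transfer_mul,
      ← transfer_mul]
    abel
  refine ⟨ε • (c ᵥ* (ρ.transfer b G * ((1 : Matrix P P ℤ) ⊗ₖ ρ.gram b))),
    -(c ᵥ* ρ.transfer b H'), ?_, ?_⟩
  · rw [Matrix.mulVec_smul, ← Matrix.vecMul_transpose, Matrix.vecMul_vecMul, Matrix.mul_assoc,
      gram_mul_transfer_transpose, ← Matrix.mul_assoc, transfer_mul, h2, ← transfer_mul,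
      ← Matrix.vecMul_vecMul, ← Matrix.vecMul_vecMul, hc, Matrix.zero_vecMul, Matrix.zero_vecMul,
      smul_zero]
  · rw [Matrix.vecMul_smul, Matrix.smul_vecMul, smul_smul, Int.units_mul_self, one_smul,
      Matrix.vecMul_vecMul, transferForm_eq, Matrix.mul_assoc,
      ← Matrix.mul_assoc ((1 : Matrix P P ℤ) ⊗ₖ ρ.gram b), kronecker_gram_mul_inv, Matrix.one_mul,
      transfer_mul, h1', Matrix.vecMul_add, Matrix.vecMul_add, Matrix.vecMul_one,
      ← Matrix.vecMul_vecMul, hc, Matrix.zero_vecMul, Matrix.neg_vecMul, Matrix.vecMul_vecMul]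
    abel

/-- Applying `α⁻¹` turns `y` into a cocycle for the conjugate-transposed differentials. The
transferred homotopy there exhibits it as a coboundary, and the Gram matrix carries the result back.
-/
lemma transfer_injective {P P' P'' Q Q' : Type} [Fintype P] [DecidableEq P] [Fintype P']
    [DecidableEq P'] [Fintype P''] [DecidableEq P''] [Fintype Q] [Fintype Q']
    {φ : Matrix P' Q' (MonoidAlgebra ℤ π)} {d : Matrix Q Q' (MonoidAlgebra ℤ π)}
    {e : Matrix P'' P' (MonoidAlgebra ℤ π)} {e' : Matrix P' P (MonoidAlgebra ℤ π)}
    {G : Matrix Q' P' (MonoidAlgebra ℤ π)} {G' : Matrix Q P (MonoidAlgebra ℤ π)}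
    {H : Matrix P'' P' (MonoidAlgebra ℤ π)} {H' : Matrix P' P (MonoidAlgebra ℤ π)}
    (h1 : φ * G - 1 = eᴴ * H + H' * e'ᴴ) (h2 : d * G = G' * e'ᴴ) (ε : ℤˣ) (y : P' × κ → ℤ)
    (hy : ρ.transfer b e *ᵥ y = 0) (u : Q × κ → ℤ)
    (hu : y ᵥ* (ε • ρ.transferForm b φ) = u ᵥ* ρ.transfer b d) :
    ∃ w, ρ.transfer b e' *ᵥ w = y := by
  have h1' : ρ.transfer b (φ * G) =
      1 + ρ.transfer b eᴴ * ρ.transfer b H + ρ.transfer b H' * ρ.transfer b e'ᴴ := by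
    rw [sub_eq_iff_eq_add.mp h1, transfer_add, transfer_add, transfer_one, ← transfer_mul,
      ← transfer_mul]
    abel
  set y' := y ᵥ* ((1 : Matrix P' P' ℤ) ⊗ₖ (ρ.gram b)⁻¹) with hy'
  have e1 : y' ᵥ* ρ.transfer b eᴴ = 0 := by
    rw [hy', Matrix.vecMul_vecMul, ← transfer_transpose_mul_inv, ← Matrix.vecMul_vecMul,
      Matrix.vecMul_transpose, hy, Matrix.zero_vecMul]
  have e2 : y' ᵥ* ρ.transfer b φ = ε • (u ᵥ* ρ.transfer b d) := by
    rw [← hu, Matrix.vecMul_smul, smul_smul, Int.units_mul_self, one_smul, transferForm_eq,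
      ← Matrix.vecMul_vecMul]
  have e3 : y' ᵥ* ρ.transfer b (φ * G) = (ε • (u ᵥ* ρ.transfer b G')) ᵥ* ρ.transfer b e'ᴴ := by
    rw [← transfer_mul, ← Matrix.vecMul_vecMul, e2, Matrix.smul_vecMul, Matrix.smul_vecMul,
      Matrix.vecMul_vecMul, Matrix.vecMul_vecMul, transfer_mul, transfer_mul, h2]
  rw [h1', Matrix.vecMul_add, Matrix.vecMul_add, Matrix.vecMul_one, ← Matrix.vecMul_vecMul, e1,
    Matrix.zero_vecMul, add_zero, ← Matrix.vecMul_vecMul] at e3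
  have e4 : y' = (ε • (u ᵥ* ρ.transfer b G') - y' ᵥ* ρ.transfer b H') ᵥ* ρ.transfer b e'ᴴ := by
    rw [Matrix.sub_vecMul, ← e3]
    abel
  have e5 : y = y' ᵥ* ((1 : Matrix P' P' ℤ) ⊗ₖ ρ.gram b) := by
    rw [hy', Matrix.vecMul_vecMul, kronecker_inv_mul_gram, Matrix.vecMul_one]
  refine ⟨(ε • (u ᵥ* ρ.transfer b G') - y' ᵥ* ρ.transfer b H') ᵥ*
    ((1 : Matrix P P ℤ) ⊗ₖ ρ.gram b), ?_⟩
  rw [← Matrix.vecMul_transpose, Matrix.vecMul_vecMul, gram_mul_transfer_transpose,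
    ← Matrix.vecMul_vecMul, ← e4, ← e5]

lemma UMatrix_intCast_zmod_four (hρ : ρ.IsZ4Trivial) (r : MonoidAlgebra ℤ π) (i j : κ) :
    ((ρ.UMatrix b r i j : ℤ) : ZMod 4) = (ρ.trivial.UMatrix b r i j : ℤ) := by
  have h := congrArg (fun t => TensorProduct.lid ℤ (ZMod 4) ((b.coord j).rTensor (ZMod 4) t))
    (LinearMap.congr_fun (hρ r) (b i ⊗ₜ (1 : ZMod 4)))
  simp only [LinearMap.rTensor_tmul, TensorProduct.lid_tmul, zsmul_one] at h
  simpa [UMatrix, LinearMap.toMatrix_apply, trivial] using h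

lemma transfer_intCast_zmod_four (hρ : ρ.IsZ4Trivial) {I J : Type}
    (f : Matrix I J (MonoidAlgebra ℤ π)) :
    (ρ.transfer b f).map (Int.cast : ℤ → ZMod 4) = (ρ.trivial.transfer b f).map Int.cast := by
  ext ⟨i, a⟩ ⟨j, c⟩
  exact ρ.UMatrix_intCast_zmod_four b hρ _ _ _

/-- The inverse Gram matrix is the same for `ρ` and `ρ.trivial`; only the action has to be compared
modulo 4. -/
lemma smul_transferForm_intCast_zmod_four (hρ : ρ.IsZ4Trivial) {I J : Type} [Fintype I]
    [DecidableEq I] (ε : ℤˣ) (f : Matrix I J (MonoidAlgebra ℤ π)) :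
    (ε • ρ.transferForm b f).map (Int.cast : ℤ → ZMod 4) =
      (ε • ρ.trivial.transferForm b f).map Int.cast := by
  have h : (ρ.transfer b (ε • f)).map (Int.castRingHom (ZMod 4)) =
    (ρ.trivial.transfer b (ε • f)).map (Int.castRingHom (ZMod 4)) :=
    ρ.transfer_intCast_zmod_four b hρ _
  rw [← transferForm_smul, ← transferForm_smul]
  change (ρ.transferForm b (ε • f)).map (Int.castRingHom (ZMod 4)) =
    (ρ.trivial.transferForm b (ε • f)).map (Int.castRingHom (ZMod 4))
  rw [transferForm_eq, transferForm_eq, Matrix.map_mul, Matrix.map_mul, h]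
  rfl

end SymmetricRepresentation

namespace SymmetricComplex

open SymmetricRepresentation

variable {π A : Type*} [Group π] [AddCommGroup A] {m : ℕ} {κ : Type} [Fintype κ] [DecidableEq κ]

theorem middleDuality_tensor {n k : ℤ} {C : SymmetricComplex (MonoidAlgebra ℤ π) n}
    (hC : C.IsPoincare) (ρ : SymmetricRepresentation π A m) (b : Module.Basis κ ℤ A)
    (hN : 4 * k = n + 2 * m) :
    MiddleDuality ((C.tensor ρ b hN).d (2 * k) (2 * k - 1))
      ((C.tensor ρ b hN).d (2 * k + 1) (2 * k)) ((C.tensor ρ b hN).φ 0 (2 * k) (2 * k)) where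
  d_comp_d := (C.tensor ρ b hN).d_comp_d _ _ _
  left := by
    have h := (C.tensor ρ b hN).φ_zero (2 * k - 1) (2 * k) (2 * k) (2 * k + 1) (by ring) rfl (by ring)
    rw [Matrix.conjTranspose_eq_transpose_of_trivial] at h
    have he : (2 * k).negOnePow = 1 := Int.negOnePow_two_mul k
    rw [he, one_smul] at h
    exact ⟨-((C.tensor ρ b hN).φ 0 (2 * k - 1) (2 * k + 1)), by
      rw [Matrix.neg_mul]; exact eq_neg_of_add_eq_zero_right h⟩
  symm := by
    have h := (C.tensor ρ b hN).φ_succ 0 (2 * k) (2 * k + 1) (2 * k) (2 * k + 1) rfl rfl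
      (by push_cast; ring)
    rw [Matrix.conjTranspose_eq_transpose_of_trivial,
      Matrix.conjTranspose_eq_transpose_of_trivial] at h
    have he : (2 * k).negOnePow = 1 := Int.negOnePow_two_mul k
    have he' : (4 * k + ((0 : ℕ) : ℤ)).negOnePow = 1 := by
      rw [Nat.cast_zero, add_zero, show 4 * k = 2 * (2 * k) by ring, Int.negOnePow_two_mul]
    -- In even middle degree `T` is plain transposition, so the relation for `φ₁` expresses the
    -- antisymmetric difference `φ₀ - φ₀ᵀ` through differentials.
    have he'' : (((0 : ℕ) : ℤ) + 1).negOnePow * (2 * k * (2 * k)).negOnePow = -1 := by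
      rw [mul_assoc 2 k, Int.negOnePow_two_mul, mul_one]
      simp
    rw [he, he', he'', one_smul, one_smul, Units.neg_smul, one_smul, ← sub_eq_add_neg] at h
    refine ⟨-((C.tensor ρ b hN).φ (0 + 1) (2 * k) (2 * k + 1)),
      -((C.tensor ρ b hN).φ (0 + 1) (2 * k + 1) (2 * k)), ?_⟩
    rw [Matrix.neg_mul, Matrix.mul_neg, ← neg_add]
    exact eq_neg_of_add_eq_zero_right h
  right := by
    have h := (C.tensor ρ b hN).φ_zero (2 * k) (2 * k + 1) (2 * k - 1) (2 * k) rfl (by ring) (by ring)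
    rw [Matrix.conjTranspose_eq_transpose_of_trivial] at h
    obtain ⟨G, G', H, H', h1, h2⟩ := hC.exists_rightInverse (2 * k - m) (2 * k + 1 - m)
      (2 * k + 1 + 1 - m) (2 * k - m) (2 * k - 1 - m) (by omega) (by omega) (by omega) (by omega)
    refine ⟨-((2 * k - 1).negOnePow • (C.tensor ρ b hN).φ 0 (2 * k + 1) (2 * k - 1)), ?_, ?_⟩
    · rw [Matrix.mul_neg, Matrix.mul_smul]
      exact eq_neg_of_add_eq_zero_left h
    · rintro x y hxy ⟨u, hu⟩
      -- The unit combines the sign of `φ'` with the product sign of `tensor` in degree `2k + 1`.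
      -- The cocycle condition on `y` holds because `2y` is a coboundary and cochains are
      -- torsion-free.
      refine ρ.transfer_injective b h1 h2
        (-((2 * k - 1).negOnePow * ((2 * k + 1 - m) * m).negOnePow)) y ?_ u ?_
      · have h3 := (C.tensor ρ b hN).d_comp_d (2 * k + 1 + 1) (2 * k + 1) (2 * k)
        have h4 : (2 : ℤ) • ((C.tensor ρ b hN).d (2 * k + 1 + 1) (2 * k + 1) *ᵥ y) = (2 : ℤ) • 0 := by
          rw [← Matrix.mulVec_smul, ← hxy, Matrix.mulVec_mulVec, h3]
          simp
        exact smul_right_injective _ (two_ne_zero : (2 : ℤ) ≠ 0) h4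
      · refine Eq.trans ?_ hu
        rw [Units.neg_smul, mul_smul]
        rfl
  surj := by
    obtain ⟨G, G', H, H', h1, h2⟩ := hC.exists_leftInverse (2 * k - m) (2 * k + 1 - m)
      (2 * k - m) (2 * k - 1 - m) (2 * k + 1 - m) (by omega) (by omega) (by omega) (by omega)
    intro c hc
    exact ρ.transfer_surjective b h1 h2 (((2 * k - m) * m).negOnePow) c hc

end SymmetricComplex

/-! ### From the common Gauss sum to the congruence modulo 8. -/

lemma zetaEight_zpow_eq {s t : ℤ} {x : ℂ} (hs : PosProportional x (zetaEight ^ s))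
    (ht : PosProportional x (zetaEight ^ t)) : s ≡ t [ZMOD 8] := by
  obtain ⟨c, hc, h⟩ := hs.symm.trans ht
  have hn : ∀ s : ℤ, ‖zetaEight ^ s‖ = 1 := by
    intro s
    have : ‖zetaEight‖ = 1 := by
      rw [zetaEight, show Real.pi * Complex.I / 4 = ((Real.pi / 4 : ℝ) : ℂ) * Complex.I by
        push_cast; ring]
      exact Complex.norm_exp_ofReal_mul_I _
    rw [norm_zpow, this, one_zpow]
  -- Both powers lie on the unit circle, so comparing norms removes the positive factor.
  have hc1 : c = 1 := by
    have h1 := congrArg norm h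
    rw [norm_mul, hn, hn, mul_one, Complex.norm_real, Real.norm_of_nonneg hc.le] at h1
    exact h1.symm
  rw [hc1, Complex.ofReal_one, one_mul, zetaEight, ← Complex.exp_int_mul, ← Complex.exp_int_mul,
    Complex.exp_eq_exp_iff_exists_int] at h
  obtain ⟨j, hj⟩ := h
  have h2 : (s : ℂ) = t + 8 * j := by
    have := Complex.two_pi_I_ne_zero
    have h3 : (2 * Real.pi * Complex.I) * (s : ℂ) = (2 * Real.pi * Complex.I) * (t + 8 * j) := by
      linear_combination 8 * hj
    exact mul_left_cancel₀ this h3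
  have h4 : s = t + 8 * j := by exact_mod_cast h2
  rw [h4]
  exact Int.modEq_iff_dvd.mpr ⟨-j, by ring⟩

/-- The signature of a symmetric complex over `ℤ` with duality in the middle dimension is determined
modulo 8 by the phase of its Gauss sum modulo 4. -/
theorem SymmetricComplex.gaussSumModFour_signature {k : ℤ} (C : SymmetricComplex ℤ (4 * k))
    (h : MiddleDuality (C.d (2 * k) (2 * k - 1)) (C.d (2 * k + 1) (2 * k))
      (C.φ 0 (2 * k) (2 * k))) :
    PosProportional (gaussSumModFour ((C.d (2 * k + 1) (2 * k)).map (Int.cast : ℤ → ZMod 4))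
      ((C.φ 0 (2 * k) (2 * k)).map (Int.cast : ℤ → ZMod 4))) (zetaEight ^ C.signature) := by
  obtain ⟨J, _, v, a, ha, hortho, hdiag, hQ⟩ := exists_rational_diagonalisation
    (C.d (2 * k + 1) (2 * k)) (C.φ 0 (2 * k) (2 * k))
    fun z w => h.pairing_symm z.2 w.2
  rw [C.signature_eq_sum_sign v a ha hortho hdiag hQ]
  exact h.gaussSumModFour_phase v a ha hortho hdiag hQ

/-- The signature of the product of a symmetric Poincaré complex over `ℤ[π]` with a `ℤ₄`-trivial
symmetric representation agrees modulo 8 with that of the product with the trivial action. -/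
theorem mainTheorem3 {π A : Type*} [Group π] [AddCommGroup A]
    (k m n : ℕ) (hkmn : (4 * k : ℤ) = 2 * n + 2 * m)
    {κ : Type} [Fintype κ] [DecidableEq κ] (b : Module.Basis κ ℤ A)
    (C : SymmetricComplex (MonoidAlgebra ℤ π) (2 * n)) (hC : C.IsPoincare)
    (ρ : SymmetricRepresentation π A m) (hρ : ρ.IsZ4Trivial) :
    (C.tensor ρ b hkmn).signature ≡ (C.tensor ρ.trivial b hkmn).signature [ZMOD 8] := by
  have h1 := (C.tensor ρ b hkmn).gaussSumModFour_signature
    (SymmetricComplex.middleDuality_tensor hC ρ b hkmn)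
  have h2 := (C.tensor ρ.trivial b hkmn).gaussSumModFour_signature
    (SymmetricComplex.middleDuality_tensor hC ρ.trivial b hkmn)
  have e1 : ((C.tensor ρ b hkmn).d (2 * k + 1) (2 * k)).map (Int.cast : ℤ → ZMod 4) =
      ((C.tensor ρ.trivial b hkmn).d (2 * k + 1) (2 * k)).map (Int.cast : ℤ → ZMod 4) :=
    ρ.transfer_intCast_zmod_four b hρ _
  have e2 : ((C.tensor ρ b hkmn).φ 0 (2 * k) (2 * k)).map (Int.cast : ℤ → ZMod 4) =
      ((C.tensor ρ.trivial b hkmn).φ 0 (2 * k) (2 * k)).map (Int.cast : ℤ → ZMod 4) :=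
    ρ.smul_transferForm_intCast_zmod_four b hρ _ _
  -- After rewriting by `e1` and `e2`, the two Gauss sums are literally the same complex number.
  refine zetaEight_zpow_eq h1 ?_
  rw [e1, e2]
  exact h2
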